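/- Let $n\ge 2$, let $\Bbbk$ be a field and $q\in\Bbbk$, $q\neq 0$ (for instance $\Bbbk$ algebraically closed of characteristic different from $p$ and $q$ the image in $\Bbbk$ of the cardinality of the residue field of a finite extension of $\mathbb{Q}_p$). Let $\mathfrak{S}$ be the symmetric group on $n$ letters with simple reflections $\mathbb{I}=\{s_1,\dots,s_{n-1}\}$, let $\mathfrak{X}$ be the group of Laurent monomials in $X_1,\dots,X_n$, and let $W=\mathfrak{S}\ltimes\mathfrak{X}$ be the extended affine Weyl group of $\mathrm{GL}_n$, with $\sigma X_i\sigma^{-1}=X_{\sigma(i)}$. Put $\tau=s_{n-1}\cdots s_1X_1$ and $s_0=(1\,n)X_1X_n^{-1}$. The length $\ell(w)$ is the least $m$ such that $w=s_{i_1}\cdots s_{i_m}\tau^j$ with $i_1,\dots,i_m\in\{0,\dots,n-1\}$ and $j\in\mathbb{Z}$. Let $H$ be the Iwahori--Matsumoto Hecke algebra: the unital $\Bbbk$-algebra generated by $T_w$ $(w\in W)$ with relations $T_1=1$, $T_xT_y=T_{xy}$ if $\ell(xy)=\ell(x)+\ell(y)$, and $(T_{s_i}-q)(T_{s_i}+1)=0$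 for $0\le i\le n-1$. For $J\subseteq\mathbb{I}$ let $W_J=\langle J\rangle$ and $v_J=\sum_{w\in W_J}T_w$. Call $X_1^{a_1}\cdots X_n^{a_n}$ $J$-dominant if $a_i\ge a_j$ whenever $i\le j$ and $X_i$, $X_j$ are conjugate under $W_J$. For $K,J\subseteq\mathbb{I}$ let $D^{\mathbb{I}}_{K,J}\subseteq\mathfrak{S}$ be the set of shortest representatives of the double cosets in $W_K\backslash\mathfrak{S}/W_J$. For $w\in\mathfrak{S}$ write $K_1\cap w^{-1}K_2=\{t\in K_1\mid wtw^{-1}\in K_2\}$ and $wJ=\{t\in\mathbb{I}\mid w^{-1}tw\in J\}$. (1) For all $K,J\subseteq\mathbb{I}$ and $d\in W$ there is a (necessarily unique) homomorphism of right $H$-modules $b^d_{K,J}\colon v_JH\to v_KH$ with $b^d_{K,J}(v_J)=\sum_{u\in W_KdW_J}T_u$. (2) For all $K_1,K_2\subseteq\mathbb{I}$ the products $$b^1_{K_2,wJ}\;b^w_{wJ,J}\;b^p_{J,J}\;b^1_{J,K_1},\qquad w\in D^{\mathbb{I}}_{K_2,K_1},\quad J=K_1\cap w^{-1}K_2,\quad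 p\in\mathfrak{X}\ \text{$J$-dominant},$$ indexed by the pairs $(w,p)$, form a $\Bbbk$-basis of $\mathrm{Hom}_H(v_{K_1}H,v_{K_2}H)$. (3) Taken over all pairs $(K_1,K_2)$ and extended by zero to the other summands, these products form a $\Bbbk$-basis of the affine Schur algebra $\mathcal{S}=\mathrm{End}_H\bigl(\bigoplus_{J\subseteq\mathbb{I}}v_JH\bigr)$. -/

import Mathlib

/-!
Throughout, `n = r + 1`.  Permutations act on `Fin (r + 1)`, so that the index `i : Fin r` stands
for the simple reflection exchanging the neighbouring positions `i.castSucc` and `i.succ`.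
-/

namespace AffSchur

/-- The permutation action of the symmetric group on the group of Laurent monomials
`X^a = ∏ X_i ^ (a i)`, written by exponent vectors; `σ X_i σ⁻¹ = X_{σ i}`. -/
def permAction (r : ℕ) :
    Equiv.Perm (Fin (r + 1)) →* MulAut (Multiplicative (Fin (r + 1) → ℤ)) where
  toFun σ :=
    { toFun := fun a => Multiplicative.ofAdd (fun i => a.toAdd (σ⁻¹ i))
      invFun := fun a => Multiplicative.ofAdd (fun i => a.toAdd (σ i))
      left_inv := fun a => by
        apply Multiplicative.toAdd.injective
        funext i
        simp
      right_inv := fun a => by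
        apply Multiplicative.toAdd.injective
        funext i
        simp
      map_mul' := fun a b => rfl }
  map_one' := rfl
  map_mul' _ _ := by
    ext a : 1
    apply Multiplicative.toAdd.injective
    funext i
    simp

/-- The extended affine Weyl group of `GL_{r+1}`: the semidirect product of the symmetric group
with the lattice of Laurent monomials. -/
abbrev W (r : ℕ) : Type :=
  Multiplicative (Fin (r + 1) → ℤ) ⋊[permAction r] Equiv.Perm (Fin (r + 1))

/-- A permutation as an element of the extended affine Weyl group. -/
def perm {r : ℕ} (σ : Equiv.Perm (Fin (r + 1))) : W r := SemidirectProduct.inr σ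

/-- The monomial `X^a` as an element of the extended affine Weyl group. -/
def mono {r : ℕ} (a : Fin (r + 1) → ℤ) : W r := SemidirectProduct.inl (Multiplicative.ofAdd a)

/-- The variable `X_i`. -/
def var {r : ℕ} (i : Fin (r + 1)) : W r := mono (Pi.single i 1)

/-- The finite simple reflections `s_1, …, s_{n-1}`. -/
def s {r : ℕ} (i : Fin r) : W r := perm (Equiv.swap i.castSucc i.succ)

/-- The affine simple reflection `s_0 = (1 n) X_1 X_n⁻¹`. -/
def sZero (r : ℕ) : W r :=
  perm (Equiv.swap 0 (Fin.last r)) * var 0 * (var (Fin.last r))⁻¹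

/-- All simple reflections `s_0, s_1, …, s_{n-1}`. -/
def sAff {r : ℕ} (i : Fin (r + 1)) : W r := Fin.cases (sZero r) s i

/-- The element `τ = s_{n-1} ⋯ s_1 X_1`; the product `s_{n-1} ⋯ s_1` is the cycle `i ↦ i - 1`. -/
def tau (r : ℕ) : W r := perm (finRotate (r + 1))⁻¹ * var 0

/-- The length of `w`: the least number of simple reflections in an expression
`w = s_{i_1} ⋯ s_{i_m} τ ^ j`. -/
noncomputable def len {r : ℕ} (w : W r) : ℕ :=
  sInf {m | ∃ (l : List (Fin (r + 1))) (j : ℤ), l.length = m ∧ w = (l.map sAff).prod * tau r ^ j}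

/-- The parabolic subgroup generated by the reflections in `J`. -/
def parabolic {r : ℕ} (J : Finset (Fin r)) : Subgroup (W r) :=
  Subgroup.closure (s '' (J : Set (Fin r)))

/-- The double coset `W_K d W_J`. -/
def dcoset {r : ℕ} (K J : Finset (Fin r)) (d : W r) : Set (W r) :=
  {u | ∃ x ∈ parabolic K, ∃ y ∈ parabolic J, u = x * d * y}

theorem parabolic_finite {r : ℕ} (J : Finset (Fin r)) : (parabolic J : Set (W r)).Finite := by
  have h : parabolic J ≤ (SemidirectProduct.inr : Equiv.Perm (Fin (r + 1)) →* W r).range := by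
    rw [parabolic, Subgroup.closure_le]
    rintro _ ⟨i, -, rfl⟩
    exact ⟨_, rfl⟩
  exact (Set.finite_range (SemidirectProduct.inr : Equiv.Perm (Fin (r + 1)) →* W r)).subset h

theorem dcoset_finite {r : ℕ} (K J : Finset (Fin r)) (d : W r) : (dcoset K J d).Finite := by
  refine (((parabolic_finite K).prod (parabolic_finite J)).image
    (fun z => z.1 * d * z.2)).subset ?_
  rintro _ ⟨x, hx, y, hy, rfl⟩
  exact ⟨(x, y), ⟨hx, hy⟩, rfl⟩

/-- Shortest representatives in the symmetric group of the double cosets `W_K \ 𝔖 / W_J`. -/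
def shortest {r : ℕ} (K J : Finset (Fin r)) : Set (Equiv.Perm (Fin (r + 1))) :=
  {w | ∀ u ∈ dcoset K J (perm w), len (perm w) ≤ len u}

open Classical in
/-- `K₁ ∩ w⁻¹ K₂`: the reflections `t` in `K₁` with `w t w⁻¹` in `K₂`. -/
noncomputable def meet {r : ℕ} (K₁ K₂ : Finset (Fin r)) (w : Equiv.Perm (Fin (r + 1))) :
    Finset (Fin r) :=
  K₁.filter fun i => ∃ j ∈ K₂, perm w * s i * (perm w)⁻¹ = s j

open Classical in
/-- `w J`: the simple reflections of the form `w t w⁻¹` with `t` in `J`. -/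
noncomputable def conj {r : ℕ} (w : Equiv.Perm (Fin (r + 1))) (J : Finset (Fin r)) :
    Finset (Fin r) :=
  Finset.univ.filter fun j => ∃ i ∈ J, perm w * s i * (perm w)⁻¹ = s j

/-- `X^a` is `J`-dominant: `a i ≥ a j` whenever `i ≤ j` and `X_i`, `X_j` are conjugate
under `W_J`. -/
def Dominant {r : ℕ} (J : Finset (Fin r)) (a : Fin (r + 1) → ℤ) : Prop :=
  ∀ i j, i ≤ j → (∃ g ∈ parabolic J, g * var i * g⁻¹ = var j) → a j ≤ a i

section Hecke

variable {k : Type*} [Field k]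

/-- The Iwahori-Matsumoto relations between the generators `T_w`. -/
inductive HeckeRel (q : k) (r : ℕ) : FreeAlgebra k (W r) → FreeAlgebra k (W r) → Prop
  | one : HeckeRel q r (FreeAlgebra.ι k 1) 1
  | mul (x y : W r) (h : len (x * y) = len x + len y) :
      HeckeRel q r (FreeAlgebra.ι k x * FreeAlgebra.ι k y) (FreeAlgebra.ι k (x * y))
  | quad (i : Fin (r + 1)) :
      HeckeRel q r
        ((FreeAlgebra.ι k (sAff i) - algebraMap k _ q) * (FreeAlgebra.ι k (sAff i) + 1)) 0

/-- The Iwahori-Matsumoto Hecke algebra with parameter `q` of the extended affine Weyl group. -/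
def Hecke (q : k) (r : ℕ) : Type _ := RingQuot (HeckeRel q r)

noncomputable instance (q : k) (r : ℕ) : Ring (Hecke q r) :=
  inferInstanceAs (Ring (RingQuot (HeckeRel q r)))

noncomputable instance (q : k) (r : ℕ) : Algebra k (Hecke q r) :=
  inferInstanceAs (Algebra k (RingQuot (HeckeRel q r)))

/-- The element `T_w` of the Hecke algebra. -/
noncomputable def T (q : k) {r : ℕ} (w : W r) : Hecke q r :=
  RingQuot.mkAlgHom k (HeckeRel q r) (FreeAlgebra.ι k w)

/-- `v_J = ∑_{w ∈ W_J} T_w` (a finite sum). -/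
noncomputable def v (q : k) {r : ℕ} (J : Finset (Fin r)) : Hecke q r :=
  ∑ w ∈ (parabolic_finite J).toFinset, T q w

/-- The right ideal `v_J H`; right `H`-modules are modules over the opposite ring. -/
noncomputable def ideal (q : k) {r : ℕ} (J : Finset (Fin r)) :
    Submodule (Hecke q r)ᵐᵒᵖ (Hecke q r) :=
  Submodule.span _ {v q J}

/-- `v_J` as an element of `v_J H`. -/
noncomputable def gen (q : k) {r : ℕ} (J : Finset (Fin r)) : ideal q J :=
  ⟨v q J, Submodule.mem_span_singleton_self _⟩

/-- `Hom_H(v_J H, v_K H)`. -/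
abbrev HomH (q : k) {r : ℕ} (J K : Finset (Fin r)) : Type _ :=
  ideal q J →ₗ[(Hecke q r)ᵐᵒᵖ] ideal q K

/-- `∑_{u ∈ W_K d W_J} T_u` (a finite sum). -/
noncomputable def dsum (q : k) {r : ℕ} (K J : Finset (Fin r)) (d : W r) : Hecke q r :=
  ∑ u ∈ (dcoset_finite K J d).toFinset, T q u

/-- A homomorphism out of `v_J H` is determined by its value at `v_J`. -/
theorem hom_ext (q : k) {r : ℕ} {J K : Finset (Fin r)} {f g : HomH q J K}
    (h : f (gen q J) = g (gen q J)) : f = g := by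
  ext ⟨x, hx⟩
  obtain ⟨a, rfl⟩ := Submodule.mem_span_singleton.1 hx
  have e : (⟨a • v q J, hx⟩ : ideal q J) = a • gen q J := rfl
  rw [e, map_smul, map_smul, h]

open Classical in
/-- The homomorphism `b^d_{K,J} : v_J H → v_K H`, determined by
`b^d_{K,J} (v_J) = ∑_{u ∈ W_K d W_J} T_u`.  (That such a homomorphism always exists is part of
the theorem; the value `0` is never used.) -/
noncomputable def b (q : k) {r : ℕ} (K J : Finset (Fin r)) (d : W r) : HomH q J K :=
  if h : ∃ f : HomH q J K, (f (gen q J) : Hecke q r) = dsum q K J d then h.choose else 0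

/-- The labels `(w, p)` of the proposed basis of `Hom_H(v_{K₁} H, v_{K₂} H)`. -/
def Label {r : ℕ} (K₂ K₁ : Finset (Fin r)) : Type :=
  {x : Equiv.Perm (Fin (r + 1)) × (Fin (r + 1) → ℤ) //
    x.1 ∈ shortest K₂ K₁ ∧ Dominant (meet K₁ K₂ x.1) x.2}

/-- The product `b^1_{K₂,wJ} b^w_{wJ,J} b^p_{J,J} b^1_{J,K₁}` with `J = K₁ ∩ w⁻¹ K₂`. -/
noncomputable def basisElt (q : k) {r : ℕ} (K₂ K₁ : Finset (Fin r)) (x : Label K₂ K₁) :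
    HomH q K₁ K₂ :=
  let w := x.1.1
  let p := x.1.2
  let J := meet K₁ K₂ w
  b q K₂ (conj w J) 1 ∘ₗ b q (conj w J) J (perm w) ∘ₗ b q J J (mono p) ∘ₗ b q J K₁ 1

/-- The affine Schur algebra `End_H(⨁_J v_J H)`. -/
abbrev Schur (q : k) (r : ℕ) : Type _ :=
  Module.End (Hecke q r)ᵐᵒᵖ (DirectSum (Finset (Fin r)) fun J => ideal q J)

/-- A homomorphism `v_J H → v_K H` as an element of the affine Schur algebra, extended by zero
on the other summands. -/
noncomputable def toSchur (q : k) {r : ℕ} {J K : Finset (Fin r)} (f : HomH q J K) :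
    Schur q r :=
  DirectSum.lof (Hecke q r)ᵐᵒᵖ (Finset (Fin r)) (fun L => ideal q L) K ∘ₗ f ∘ₗ
    DirectSum.component (Hecke q r)ᵐᵒᵖ (Finset (Fin r)) (fun L => ideal q L) J

end Hecke

end AffSchur

/-! Evaluation at `v_{K₁}` identifies `Hom_H(v_{K₁}H, v_{K₂}H)` with the elements `h` of `H`
satisfying `T_s h = q h` for `s` in `K₂` and `h T_s = q h` for `s` in `K₁`. Since `q ≠ 0`, these are
the elements whose coefficients in the basis `T_w` are constant on double cosets `W_{K₂} d W_{K₁}`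
(`leftConst_iff`, `rightConst_coef_iff`). Hence every double coset sum comes from a homomorphism,
which is (1), and the double coset sums form a basis of the Hom space (`exists_hom`,
`mem_span_dsum`).

The labels `(w, p)` parametrise the double cosets through `w p`. The projection to the symmetric
group determines `w`. The remaining freedom in `p` is conjugation by `W_{K₁} ∩ w⁻¹ W_{K₂} w`, which
is the parabolic subgroup `W_J`, and each `W_J`-orbit of monomials contains exactly one `J`-dominant
one (`exists_label`, `Label.eq_of_mem`).

It remains to compare products with double coset sums. Up to a nonzero scalar the product labelled
`(w, p)` takes the value `v_{K₂} T_w h₅`, where `v_J h₅` is the sum over `W_J p W_{K₁}`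
(`basisElt_gen`). Expanding `T_w T_g` gives a power of `q` times `T_{wg}` plus terms `T_{ug}` with
`u` a permutation shorter than `w`. The leading terms lie in the double coset of `w p`, and the
others lie over finite double cosets with a shorter minimal element (`basisElt_triangular`). The
diagonal coefficient is nonzero in every characteristic because exactly one `g` contributes to the
coefficient at `w p`, so that no sum of powers of `q` arises. Triangularity with respect to the
length of `w` gives (2), and (3) follows by reading endomorphisms as matrices.

All this needs the `T_w` to be a basis of `H` and the Coxeter combinatorics of `W`. Both are derived
from the action of `W` on the integers by affine permutations, in which length is a number of
inversions and the exchange condition can be read off. -/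

namespace AffSchur

/-! ### Affine permutations of the integers -/

/-- The residue class of an integer modulo `r + 1`. -/
def res (r : ℕ) (x : ℤ) : Fin (r + 1) :=
  ⟨(x % ((r : ℤ) + 1)).toNat, by
    have h1 := Int.emod_nonneg x (b := (r : ℤ) + 1) (by omega)
    have h2 := Int.emod_lt_of_pos x (b := (r : ℤ) + 1) (by omega)
    omega⟩

theorem coe_res (r : ℕ) (x : ℤ) : ((res r x : ℕ) : ℤ) = x % ((r : ℤ) + 1) := by
  have h1 := Int.emod_nonneg x (b := (r : ℤ) + 1) (by omega)
  simp [res, h1]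

theorem res_add_mul {r : ℕ} (i : Fin (r + 1)) (m : ℤ) :
    res r (((i : ℕ) : ℤ) + ((r : ℤ) + 1) * m) = i := by
  apply Fin.ext
  have h := coe_res r (((i : ℕ) : ℤ) + ((r : ℤ) + 1) * m)
  rw [Int.add_mul_emod_self_left, Int.emod_eq_of_lt (by omega) (by omega)] at h
  exact_mod_cast h

theorem add_mul_ediv {r : ℕ} (i : Fin (r + 1)) (m : ℤ) :
    (((i : ℕ) : ℤ) + ((r : ℤ) + 1) * m) / ((r : ℤ) + 1) = m := by
  rw [Int.add_mul_ediv_left _ _ (by omega), Int.ediv_eq_zero_of_lt (by omega) (by omega), zero_add]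

theorem exists_eq_add_mul (r : ℕ) (x : ℤ) :
    ∃ (i : Fin (r + 1)) (m : ℤ), x = ((i : ℕ) : ℤ) + ((r : ℤ) + 1) * m :=
  ⟨res r x, x / ((r : ℤ) + 1), by rw [coe_res, Int.emod_add_mul_ediv]⟩

theorem eq_and_eq_of_add_mul {r : ℕ} {i j : Fin (r + 1)} {m l : ℤ}
    (h : ((i : ℕ) : ℤ) + ((r : ℤ) + 1) * m = ((j : ℕ) : ℤ) + ((r : ℤ) + 1) * l) :
    i = j ∧ m = l := by
  constructor
  · rw [← res_add_mul i m, h, res_add_mul]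
  · rw [← add_mul_ediv i m, h, add_mul_ediv]

/-- The action of the extended affine Weyl group on the integers by affine permutations. -/
def zfun {r : ℕ} (w : W r) (x : ℤ) : ℤ :=
  ((w.right (res r x) : ℕ) : ℤ) +
    ((r : ℤ) + 1) * (x / ((r : ℤ) + 1) - w.left.toAdd (w.right (res r x)))

/-- With this sign the monomial `X_i` moves the class of `i` down by one period, which is what makes
`tau` the shift `x ↦ x - 1`. -/
theorem zfun_add_mul {r : ℕ} (w : W r) (i : Fin (r + 1)) (m : ℤ) :
    zfun w (((i : ℕ) : ℤ) + ((r : ℤ) + 1) * m) =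
      ((w.right i : ℕ) : ℤ) + ((r : ℤ) + 1) * (m - w.left.toAdd (w.right i)) := by
  rw [zfun, res_add_mul, add_mul_ediv]

theorem zfun_coe {r : ℕ} (w : W r) (i : Fin (r + 1)) :
    zfun w ((i : ℕ) : ℤ) =
      ((w.right i : ℕ) : ℤ) - ((r : ℤ) + 1) * w.left.toAdd (w.right i) := by
  have h := zfun_add_mul w i 0
  rw [mul_zero, add_zero] at h
  rw [h]; ring

theorem zfun_mul {r : ℕ} (u w : W r) (x : ℤ) : zfun (u * w) x = zfun u (zfun w x) := by
  obtain ⟨i, m, rfl⟩ := exists_eq_add_mul r x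
  rw [zfun_add_mul, zfun_add_mul, zfun_add_mul]
  have h : (u * w).left.toAdd ((u * w).right i) =
      u.left.toAdd (u.right (w.right i)) + w.left.toAdd (w.right i) := by
    simp [permAction]
  rw [h, SemidirectProduct.mul_right, Equiv.Perm.mul_apply]
  ring

theorem zfun_one {r : ℕ} (x : ℤ) : zfun (1 : W r) x = x := by
  obtain ⟨i, m, rfl⟩ := exists_eq_add_mul r x
  rw [zfun_add_mul]; simp

theorem zfun_inv_apply {r : ℕ} (w : W r) (x : ℤ) : zfun w⁻¹ (zfun w x) = x := by
  rw [← zfun_mul, inv_mul_cancel, zfun_one]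

theorem zfun_apply_inv {r : ℕ} (w : W r) (x : ℤ) : zfun w (zfun w⁻¹ x) = x := by
  rw [← zfun_mul, mul_inv_cancel, zfun_one]

theorem zfun_injective {r : ℕ} (w : W r) : Function.Injective (zfun w) :=
  Function.LeftInverse.injective (zfun_inv_apply w)

/-- The action is faithful: residue and quotient of the image of `i` recover the permutation and the
exponents. Identities in `W` are thereby checked on integers. -/
theorem zfun_ext {r : ℕ} {u w : W r} (h : ∀ x, zfun u x = zfun w x) : u = w := by
  have key : ∀ i, u.right i = w.right i ∧ - u.left.toAdd (u.right i) = - w.left.toAdd (w.right i) := by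
    intro i
    have h1 := h ((i : ℕ) : ℤ)
    rw [zfun_coe, zfun_coe, sub_eq_add_neg, sub_eq_add_neg, ← mul_neg, ← mul_neg] at h1
    exact eq_and_eq_of_add_mul h1
  have hr : u.right = w.right := Equiv.ext fun i => (key i).1
  refine SemidirectProduct.ext ?_ hr
  apply Multiplicative.toAdd.injective
  funext i
  have := (key (u.right⁻¹ i)).2
  rw [← hr] at this
  simpa using this

theorem zfun_add_period {r : ℕ} (w : W r) (x m : ℤ) :
    zfun w (x + ((r : ℤ) + 1) * m) = zfun w x + ((r : ℤ) + 1) * m := by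
  obtain ⟨i, l, rfl⟩ := exists_eq_add_mul r x
  rw [add_assoc, ← mul_add, zfun_add_mul, zfun_add_mul]
  ring

theorem zfun_perm_coe {r : ℕ} (σ : Equiv.Perm (Fin (r + 1))) (i : Fin (r + 1)) :
    zfun (perm σ) ((i : ℕ) : ℤ) = ((σ i : ℕ) : ℤ) := by
  rw [zfun_coe]; simp [perm]

theorem zfun_ext_coe {r : ℕ} {w : W r} {f : ℤ → ℤ}
    (hf : ∀ x m : ℤ, f (x + ((r : ℤ) + 1) * m) = f x + ((r : ℤ) + 1) * m)
    (h : ∀ i : Fin (r + 1), zfun w ((i : ℕ) : ℤ) = f ((i : ℕ) : ℤ)) (x : ℤ) : zfun w x = f x := by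
  obtain ⟨i, l, rfl⟩ := exists_eq_add_mul r x
  rw [zfun_add_period, hf, h]

theorem zfun_perm {r : ℕ} (σ : Equiv.Perm (Fin (r + 1))) (i : Fin (r + 1)) (m : ℤ) :
    zfun (perm σ) (((i : ℕ) : ℤ) + ((r : ℤ) + 1) * m) = ((σ i : ℕ) : ℤ) + ((r : ℤ) + 1) * m := by
  rw [zfun_add_period, zfun_perm_coe]

theorem zfun_mono {r : ℕ} (a : Fin (r + 1) → ℤ) (i : Fin (r + 1)) (m : ℤ) :
    zfun (mono a) (((i : ℕ) : ℤ) + ((r : ℤ) + 1) * m) =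
      ((i : ℕ) : ℤ) + ((r : ℤ) + 1) * (m - a i) := by
  rw [zfun_add_mul]; simp [mono]

theorem zfun_tau {r : ℕ} (x : ℤ) : zfun (tau r) x = x - 1 := by
  refine zfun_ext_coe (f := fun x => x - 1) (fun x m => by ring) (fun i => ?_) x
  have h1 := zfun_mono (Pi.single (0 : Fin (r + 1)) 1) i 0
  rw [mul_zero, add_zero] at h1
  rw [tau, zfun_mul, var, h1, zfun_perm]
  refine Fin.cases ?_ (fun i => ?_) i
  · have h : (finRotate (r + 1))⁻¹ 0 = Fin.last r := by
      rw [Equiv.Perm.inv_eq_iff_eq]; simp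
    rw [h]; simp
  · have h : (finRotate (r + 1))⁻¹ i.succ = i.castSucc := by
      rw [Equiv.Perm.inv_eq_iff_eq]; simp
    rw [h]; simp

/-- The affine permutation exchanging the residue classes of `j - 1` and `j`. -/
def adj (r : ℕ) (j x : ℤ) : ℤ :=
  if ((r : ℤ) + 1) ∣ x - j then x - 1 else if ((r : ℤ) + 1) ∣ x - j + 1 then x + 1 else x

theorem adj_add_period (r : ℕ) (j x m : ℤ) :
    adj r j (x + ((r : ℤ) + 1) * m) = adj r j x + ((r : ℤ) + 1) * m := by
  have h1 : ((r : ℤ) + 1) ∣ x + ((r : ℤ) + 1) * m - j ↔ ((r : ℤ) + 1) ∣ x - j := by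
    rw [show x + ((r : ℤ) + 1) * m - j = x - j + ((r : ℤ) + 1) * m by ring]
    exact dvd_add_left (dvd_mul_right _ _)
  have h2 : ((r : ℤ) + 1) ∣ x + ((r : ℤ) + 1) * m - j + 1 ↔ ((r : ℤ) + 1) ∣ x - j + 1 := by
    rw [show x + ((r : ℤ) + 1) * m - j + 1 = x - j + 1 + ((r : ℤ) + 1) * m by ring]
    exact dvd_add_left (dvd_mul_right _ _)
  simp only [adj, h1, h2]
  split_ifs <;> ring

theorem period_dvd_iff {r : ℕ} {x : ℤ} (h1 : -((r : ℤ) + 1) < x) (h2 : x < (r : ℤ) + 1) :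
    ((r : ℤ) + 1) ∣ x ↔ x = 0 := by
  refine ⟨fun h => ?_, fun h => h ▸ dvd_zero _⟩
  exact Int.eq_zero_of_abs_lt_dvd h (by rw [abs_lt]; exact ⟨h1, h2⟩)

theorem zfun_s {r : ℕ} (i : Fin r) (x : ℤ) : zfun (s i) x = adj r ((i : ℕ) + 1 : ℤ) x := by
  refine zfun_ext_coe (f := adj r _) (adj_add_period r _) (fun k => ?_) x
  have hd : ((r : ℤ) + 1) ∣ ((k : ℕ) : ℤ) - ((i : ℕ) + 1) ↔ ((k : ℕ) : ℤ) - ((i : ℕ) + 1) = 0 :=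
    period_dvd_iff (by omega) (by omega)
  have e1 : ((i.succ : Fin (r + 1)) : ℕ) = i + 1 := rfl
  have e2 : ((i.castSucc : Fin (r + 1)) : ℕ) = i := rfl
  rw [s, zfun_perm_coe, adj]
  simp only [hd]
  by_cases h1 : k = i.succ
  · subst h1
    simp
  · rw [if_neg (fun h => h1 (Fin.ext (by omega)))]
    by_cases h2 : k = i.castSucc
    · subst h2; simp
    · rw [Equiv.swap_apply_of_ne_of_ne h2 h1, if_neg]
      intro h
      apply h2
      have := (period_dvd_iff (r := r) (by omega) (by omega)).1 h
      exact Fin.ext (by omega)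

theorem zfun_sZero {r : ℕ} (hr : 1 ≤ r) (x : ℤ) : zfun (sZero r) x = adj r 0 x := by
  refine zfun_ext_coe (f := adj r _) (adj_add_period r _) (fun k => ?_) x
  have hl : (Fin.last r) ≠ 0 := by
    intro h; rw [Fin.ext_iff] at h; simp at h; omega
  have hd : ((r : ℤ) + 1) ∣ ((k : ℕ) : ℤ) ↔ ((k : ℕ) : ℤ) = 0 :=
    period_dvd_iff (by omega) (by omega)
  have e1 : ((0 : Fin (r + 1)) : ℕ) = 0 := rfl
  have e2 : ((Fin.last r : Fin (r + 1)) : ℕ) = r := rfl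
  simp only [adj, sub_zero, hd]
  have e : sZero r = perm (Equiv.swap 0 (Fin.last r)) *
      mono (Pi.single 0 1 - Pi.single (Fin.last r) 1) := by
    rw [sZero, mul_assoc, var, var, mono, mono, mono, ofAdd_sub, div_eq_mul_inv, map_mul, map_inv]
  have h1 := zfun_mono (Pi.single (0 : Fin (r + 1)) 1 - Pi.single (Fin.last r) 1) k 0
  rw [mul_zero, add_zero] at h1
  rw [e, zfun_mul, h1, zfun_perm]
  by_cases h0 : k = 0
  · subst h0; simp [hl.symm]
  · rw [if_neg (fun h => h0 (Fin.ext (by omega)))]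
    by_cases h1 : k = Fin.last r
    · subst h1; simp [hl]
    · rw [Equiv.swap_apply_of_ne_of_ne h0 h1, if_neg]
      · simp [h0, h1]
      · intro h
        apply h1
        obtain ⟨c, hc⟩ := h
        have hk := k.2
        have h3 : c = 1 := by
          have : 0 < c := by by_contra h; nlinarith
          have : c < 2 := by by_contra h; nlinarith
          omega
        subst h3
        exact Fin.ext (by omega)

theorem zfun_sAff {r : ℕ} (hr : 1 ≤ r) (j : Fin (r + 1)) (x : ℤ) :
    zfun (sAff j) x = adj r ((j : ℕ) : ℤ) x := by
  refine Fin.cases ?_ (fun i => ?_) j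
  · simpa only [sAff, Fin.cases_zero, Fin.val_zero, Nat.cast_zero] using zfun_sZero hr x
  · simpa [sAff] using zfun_s i x

theorem adj_left (r : ℕ) (j : ℤ) : adj r j j = j - 1 := by simp [adj]

theorem adj_right {r : ℕ} (hr : 1 ≤ r) (j : ℤ) : adj r j (j - 1) = j := by
  have h : ¬ ((r : ℤ) + 1) ∣ j - 1 - j := by
    rw [period_dvd_iff (by omega) (by omega)]; omega
  rw [adj, if_neg h, if_pos (by simp)]
  ring

theorem adj_congr {r : ℕ} {i j : ℤ} (h : ((r : ℤ) + 1) ∣ i - j) (x : ℤ) : adj r i x = adj r j x := by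
  have h1 : ((r : ℤ) + 1) ∣ x - i ↔ ((r : ℤ) + 1) ∣ x - j := by
    rw [show x - j = (x - i) + (i - j) by ring, dvd_add_left h]
  have h2 : ((r : ℤ) + 1) ∣ x - i + 1 ↔ ((r : ℤ) + 1) ∣ x - j + 1 := by
    rw [show x - j + 1 = (x - i + 1) + (i - j) by ring, dvd_add_left h]
  simp only [adj, h1, h2]

theorem adj_shift (r : ℕ) (j x c : ℤ) : adj r (j + c) (x + c) = adj r j x + c := by
  simp only [adj, add_sub_add_right_eq_sub]
  split_ifs <;> ring

theorem adj_eq_or (r : ℕ) (j x : ℤ) :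
    (((r : ℤ) + 1) ∣ x - j ∧ adj r j x = x - 1) ∨
    (((r : ℤ) + 1) ∣ x - (j - 1) ∧ adj r j x = x + 1) ∨
    (adj r j x = x ∧ ¬ ((r : ℤ) + 1) ∣ x - j ∧ ¬ ((r : ℤ) + 1) ∣ x - (j - 1)) := by
  have e : x - (j - 1) = x - j + 1 := by ring
  rw [e]
  by_cases h1 : ((r : ℤ) + 1) ∣ x - j
  · left; exact ⟨h1, by simp [adj, h1]⟩
  · by_cases h2 : ((r : ℤ) + 1) ∣ x - j + 1
    · right; left; exact ⟨h2, by simp [adj, h1, h2]⟩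
    · right; right; exact ⟨by simp [adj, h1, h2], h1, h2⟩

theorem adj_adj {r : ℕ} (hr : 1 ≤ r) (j x : ℤ) : adj r j (adj r j x) = x := by
  rcases adj_eq_or r j x with ⟨⟨m, h⟩, e⟩ | ⟨⟨m, h⟩, e⟩ | ⟨e, -⟩
  · rw [e, show x - 1 = (j - 1) + ((r : ℤ) + 1) * m by linarith, adj_add_period, adj_right hr]
    linarith
  · rw [e, show x + 1 = j + ((r : ℤ) + 1) * m by linarith, adj_add_period, adj_left]
    linarith
  · rw [e, e]

/-- The transposition `adj j` reverses only the order of `j - 1`, `j` and their translates. -/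
theorem eq_of_adj_lt {r : ℕ} (hr : 1 ≤ r) {j x y : ℤ} (hxy : x < y) (h : adj r j y < adj r j x) :
    ∃ m, x = (j - 1) + ((r : ℤ) + 1) * m ∧ y = j + ((r : ℤ) + 1) * m := by
  have key : ∀ m l : ℤ, ((r : ℤ) + 1) * m = ((r : ℤ) + 1) * l + 1 → False := by
    intro m l h
    have : ((r : ℤ) + 1) ∣ 1 := ⟨m - l, by linarith⟩
    rw [period_dvd_iff (by omega) (by omega)] at this
    omega
  rcases adj_eq_or r j x with ⟨⟨m, h1⟩, e⟩ | ⟨⟨m, h1⟩, e⟩ | ⟨e, h1⟩ <;>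
  rcases adj_eq_or r j y with ⟨⟨l, h2⟩, f⟩ | ⟨⟨l, h2⟩, f⟩ | ⟨f, h2⟩ <;> rw [e, f] at h <;>
    try omega
  · have hy : y = x + 1 := by
      rcases (by omega : y = x + 1 ∨ y = x + 2) with h' | h'
      · exact h'
      · exfalso
        exact key l m (by rw [← h1, ← h2]; omega) |>.elim
    exact ⟨m, by linarith, by linarith⟩

theorem sAff_mul_self {r : ℕ} (hr : 1 ≤ r) (j : Fin (r + 1)) : sAff j * sAff j = 1 :=
  zfun_ext fun x => by rw [zfun_mul, zfun_sAff hr, zfun_sAff hr, adj_adj hr, zfun_one]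

theorem sAff_inv {r : ℕ} (hr : 1 ≤ r) (j : Fin (r + 1)) : (sAff j)⁻¹ = sAff j :=
  inv_eq_of_mul_eq_one_left (sAff_mul_self hr j)

theorem sAff_mul_cancel_left {r : ℕ} (hr : 1 ≤ r) (j : Fin (r + 1)) (w : W r) :
    sAff j * (sAff j * w) = w := by
  rw [← mul_assoc, sAff_mul_self hr, one_mul]

theorem sAff_mul_cancel_right {r : ℕ} (hr : 1 ≤ r) (j : Fin (r + 1)) (w : W r) :
    w * sAff j * sAff j = w := by
  rw [mul_assoc, sAff_mul_self hr, mul_one]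

theorem dvd_sub_res (r : ℕ) (j : ℤ) : ((r : ℤ) + 1) ∣ ((res r j : ℕ) : ℤ) - j := by
  rw [coe_res]
  exact ⟨-(j / ((r : ℤ) + 1)), by have := Int.emod_add_mul_ediv j ((r : ℤ) + 1); linarith⟩

theorem zfun_sAff_res {r : ℕ} (hr : 1 ≤ r) (j : ℤ) (x : ℤ) :
    zfun (sAff (res r j)) x = adj r j x := by
  rw [zfun_sAff hr, adj_congr (dvd_sub_res r j)]

theorem zfun_tau_inv {r : ℕ} (x : ℤ) : zfun (tau r)⁻¹ x = x + 1 := by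
  have h := zfun_inv_apply (tau r) (x + 1)
  rwa [zfun_tau, add_sub_cancel_right] at h

theorem zfun_tau_zpow {r : ℕ} (m x : ℤ) : zfun (tau r ^ m) x = x - m := by
  induction m using Int.induction_on generalizing x with
  | zero => rw [zpow_zero, zfun_one, sub_zero]
  | succ k ih => rw [zpow_add_one, zfun_mul, zfun_tau, ih]; ring
  | pred k ih => rw [zpow_sub_one, zfun_mul, zfun_tau_inv, ih]; ring

/-- Conjugation by the shift `tau` rotates the affine Dynkin diagram. -/
theorem tau_zpow_mul_sAff {r : ℕ} (hr : 1 ≤ r) (m : ℤ) (j : Fin (r + 1)) :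
    tau r ^ m * sAff j = sAff (res r ((j : ℕ) - m)) * tau r ^ m := by
  apply zfun_ext
  intro x
  rw [zfun_mul, zfun_mul, zfun_tau_zpow, zfun_tau_zpow, zfun_sAff hr, zfun_sAff_res hr,
    sub_eq_add_neg, sub_eq_add_neg, sub_eq_add_neg, adj_shift]

theorem sAff_mul_tau_zpow {r : ℕ} (hr : 1 ≤ r) (m : ℤ) (j : Fin (r + 1)) :
    sAff j * tau r ^ m = tau r ^ m * sAff (res r ((j : ℕ) + m)) := by
  apply zfun_ext
  intro x
  rw [zfun_mul, zfun_mul, zfun_tau_zpow, zfun_tau_zpow, zfun_sAff hr, zfun_sAff_res hr]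
  have := adj_shift r (j : ℕ) (x - m) m
  rw [sub_add_cancel] at this
  linarith

/-! ### Length as a number of inversions -/

/-- The number of inversions of an affine permutation. -/
def inversions (r : ℕ) (f : ℤ → ℤ) : ℕ :=
  ∑ i : Fin (r + 1), ∑ j : Fin (r + 1),
    if i < j then ((f (j : ℕ) - f (i : ℕ)) / ((r : ℤ) + 1)).natAbs else 0

/-- Governs how the contribution `|⌊d / n⌋|` of a pair of classes to `inversions` changes when the
pair is exchanged. -/
theorem neg_ediv_of_not_dvd {n : ℤ} (hn : 0 < n) {d : ℤ} (h : ¬ n ∣ d) : -d / n = -(d / n) - 1 := by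
  have h1 := Int.emod_add_mul_ediv d n
  have h2 : d % n ≠ 0 := fun h' => h (Int.dvd_of_emod_eq_zero h')
  have h3 := Int.emod_nonneg d hn.ne'
  have h4 := Int.emod_lt_of_pos d hn
  rw [show -d = (n - d % n) + n * (-(d / n) - 1) by linarith, Int.add_mul_ediv_left _ _ hn.ne',
    Int.ediv_eq_zero_of_lt (by omega) (by omega), zero_add]

theorem zfun_sub_not_dvd {r : ℕ} (w : W r) {x y : ℤ} (h : ¬ ((r : ℤ) + 1) ∣ x - y) :
    ¬ ((r : ℤ) + 1) ∣ zfun w x - zfun w y := by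
  rintro ⟨m, hm⟩
  apply h
  have : zfun w x = zfun w (y + ((r : ℤ) + 1) * m) := by rw [zfun_add_period]; linarith
  exact ⟨m, by rw [zfun_injective w this]; ring⟩

/-- The swap permutes the pairs of positions among themselves and reverses the order of the pair
`(i, i + 1)` only. For that pair `|⌊d / n⌋|` becomes `|-⌊d / n⌋ - 1|`, which is one more if `d > 0`
and one less if `d < 0`. -/
theorem inversions_mul_s {r : ℕ} (w : W r) (i : Fin r) :
    ((zfun w (i : ℕ) < zfun w ((i : ℕ) + 1)) →
      inversions r (zfun (w * s i)) = inversions r (zfun w) + 1) ∧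
    (¬ (zfun w (i : ℕ) < zfun w ((i : ℕ) + 1)) →
      inversions r (zfun (w * s i)) + 1 = inversions r (zfun w)) := by
  set σ := Equiv.swap i.castSucc i.succ with hσ
  set f := zfun w
  set n : ℤ := (r : ℤ) + 1
  have hn : 0 < n := by positivity
  have e1 : ((i.succ : Fin (r + 1)) : ℕ) = i + 1 := rfl
  have e2 : ((i.castSucc : Fin (r + 1)) : ℕ) = i := rfl
  let h : Fin (r + 1) → Fin (r + 1) → ℤ := fun a b => (((f (b : ℕ) - f (a : ℕ)) / n).natAbs : ℤ)
  have A : (inversions r (zfun (w * s i)) : ℤ) =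
      ∑ p : Fin (r + 1) × Fin (r + 1), if σ p.1 < σ p.2 then h p.1 p.2 else 0 := by
    rw [Fintype.sum_prod_type, inversions]
    push_cast
    rw [← Equiv.sum_comp σ]
    refine Finset.sum_congr rfl fun a _ => ?_
    rw [← Equiv.sum_comp σ]
    refine Finset.sum_congr rfl fun b _ => ?_
    have hh : ∀ k, zfun (w * s i) ((σ k : Fin (r + 1)) : ℕ) = f (k : ℕ) := by
      intro k
      rw [zfun_mul, s, zfun_perm_coe, ← hσ, hσ, Equiv.swap_apply_self]
    simp only [hh, h, Nat.cast_natAbs, Int.cast_id]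
    rfl
  have B : (inversions r f : ℤ) =
      ∑ p : Fin (r + 1) × Fin (r + 1), if p.1 < p.2 then h p.1 p.2 else 0 := by
    rw [Fintype.sum_prod_type, inversions]
    push_cast
    simp only [h, Nat.cast_natAbs, Int.cast_id]
    rfl
  have C : (inversions r (zfun (w * s i)) : ℤ) - inversions r f =
      - h i.castSucc i.succ + h i.succ i.castSucc := by
    rw [A, B, ← Finset.sum_sub_distrib,
      Fintype.sum_eq_add (i.castSucc, i.succ) (i.succ, i.castSucc)]
    · have : ¬ i.succ < i.castSucc := by simp [Fin.lt_def]
      simp [σ, this]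
    · intro h; simp [Fin.ext_iff] at h
    · rintro ⟨a, b⟩ ⟨h1, h2⟩
      have : σ a < σ b ↔ a < b := by
        rw [hσ, Equiv.swap_apply_def, Equiv.swap_apply_def]
        simp only [ne_eq, Prod.mk.injEq, Fin.ext_iff, e1, e2] at h1 h2
        simp only [Fin.ext_iff, Fin.lt_def]
        split_ifs <;> simp only [e1, e2] at * <;> omega
      simp [this]
  have hd : ¬ n ∣ f ((i : ℕ) + 1) - f (i : ℕ) := by
    apply zfun_sub_not_dvd
    rw [period_dvd_iff (by omega) (by omega)]; omega
  have D := neg_ediv_of_not_dvd hn hd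
  have e3 : (f (i : ℕ) - f ((i : ℕ) + 1)) / n = - ((f ((i : ℕ) + 1) - f (i : ℕ)) / n) - 1 := by
    rw [← D]; congr 1; ring
  have e4 : h i.castSucc i.succ = |(f ((i : ℕ) + 1) - f (i : ℕ)) / n| := by
    simp [h]
  have e5 : h i.succ i.castSucc = |-((f ((i : ℕ) + 1) - f (i : ℕ)) / n) - 1| := by
    rw [← e3]; simp [h]
  rw [e4, e5] at C
  constructor
  · intro hlt
    have : 0 ≤ (f ((i : ℕ) + 1) - f (i : ℕ)) / n := Int.ediv_nonneg (by omega) hn.le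
    rw [abs_of_nonneg this, abs_of_neg (by omega)] at C
    omega
  · intro hlt
    have h0 : f ((i : ℕ) + 1) - f (i : ℕ) ≠ 0 := fun h => hd (h ▸ dvd_zero _)
    have : (f ((i : ℕ) + 1) - f (i : ℕ)) / n < 0 := Int.ediv_neg_of_neg_of_pos (by omega) hn
    rw [abs_of_neg this, abs_of_nonneg (by omega)] at C
    omega

/-- The shift moves the window of positions by one step. Pairs not involving the end that wraps
around are only renamed. For the others `d` is replaced by `n - d`, and `⌊(n - d) / n⌋ = -⌊d / n⌋`
because `n` does not divide `d`. -/
theorem inversions_mul_tau {r : ℕ} (w : W r) :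
    inversions r (zfun (w * tau r)) = inversions r (zfun w) := by
  have hn : (0 : ℤ) < (r : ℤ) + 1 := by positivity
  have h : ∀ x, zfun (w * tau r) x = zfun w (x - 1) := fun x => by rw [zfun_mul, zfun_tau]
  simp only [inversions, h]
  -- `A` splits off the pairs containing the first position, `B` those containing the last; the two
  -- are then matched term by term.
  have A : ∀ g : Fin (r + 1) → Fin (r + 1) → ℕ,
      (∑ i, ∑ j, if i < j then g i j else 0) =
        ∑ j : Fin r, g 0 j.succ + ∑ i : Fin r, ∑ j : Fin r, if i < j then g i.succ j.succ else 0 := by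
    intro g
    rw [Fin.sum_univ_succ]
    congr 1
    · rw [Fin.sum_univ_succ]; simp
    · refine Finset.sum_congr rfl fun i _ => ?_
      rw [Fin.sum_univ_succ]; simp
  have B : ∀ g : Fin (r + 1) → Fin (r + 1) → ℕ,
      (∑ i, ∑ j, if i < j then g i j else 0) =
        ∑ i : Fin r, g i.castSucc (Fin.last r) +
          ∑ i : Fin r, ∑ j : Fin r, if i < j then g i.castSucc j.castSucc else 0 := by
    intro g
    rw [Fin.sum_univ_castSucc, add_comm]
    have : ∀ j : Fin (r + 1), ¬ Fin.last r < j := fun j => not_lt.2 (Fin.le_last j)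
    simp only [this, if_false, Finset.sum_const_zero, zero_add, Fin.sum_univ_castSucc (n := r),
      Finset.sum_add_distrib, Fin.castSucc_lt_last, if_true, Fin.castSucc_lt_castSucc_iff]
    rw [add_comm]
  rw [A, B]
  congr 1
  · refine Finset.sum_congr rfl fun i _ => ?_
    have e1 : ((i.succ : Fin (r + 1)) : ℕ) = i + 1 := rfl
    have e2 : ((i.castSucc : Fin (r + 1)) : ℕ) = i := rfl
    have e3 := zfun_add_period w (-1) 1
    rw [show (-1 : ℤ) + ((r : ℤ) + 1) * 1 = r by ring] at e3
    have hd : ¬ ((r : ℤ) + 1) ∣ zfun w (r : ℤ) - zfun w ((i : ℕ) : ℤ) := by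
      apply zfun_sub_not_dvd
      rw [period_dvd_iff (by omega) (by omega)]; omega
    have D := neg_ediv_of_not_dvd hn hd
    rw [e1, e2, Fin.val_zero, Fin.val_last]
    push_cast
    rw [add_sub_cancel_right,
      show zfun w ((i : ℕ) : ℤ) - zfun w (-1) =
        -(zfun w (r : ℤ) - zfun w ((i : ℕ) : ℤ)) + ((r : ℤ) + 1) * 1 by rw [e3]; ring,
      Int.add_mul_ediv_left _ _ hn.ne', D, sub_add_cancel, Int.natAbs_neg]
  · refine Finset.sum_congr rfl fun i _ => Finset.sum_congr rfl fun j _ => ?_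
    simp

theorem inversions_mul_tau_zpow {r : ℕ} (w : W r) (m : ℤ) :
    inversions r (zfun (w * tau r ^ m)) = inversions r (zfun w) := by
  induction m using Int.induction_on with
  | zero => rw [zpow_zero, mul_one]
  | succ k ih => rw [zpow_add_one, ← mul_assoc, inversions_mul_tau, ih]
  | pred k ih => rw [← ih, ← inversions_mul_tau, mul_assoc, ← zpow_add_one, sub_add_cancel]

/-- The case of `s_0` reduces to that of `s_1` through `s_0 = τ s_1 τ⁻¹`, since `τ` does not change
the number of inversions. -/
theorem inversions_mul_sAff {r : ℕ} (hr : 1 ≤ r) (w : W r) (j : Fin (r + 1)) :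
    ((zfun w ((j : ℕ) - 1) < zfun w (j : ℕ)) →
      inversions r (zfun (w * sAff j)) = inversions r (zfun w) + 1) ∧
    (¬ (zfun w ((j : ℕ) - 1) < zfun w (j : ℕ)) →
      inversions r (zfun (w * sAff j)) + 1 = inversions r (zfun w)) := by
  refine Fin.cases ?_ (fun i => ?_) j
  · have h := inversions_mul_s (w * tau r) ⟨0, hr⟩
    have e : sAff (0 : Fin (r + 1)) = tau r * s ⟨0, hr⟩ * (tau r)⁻¹ := by
      apply zfun_ext
      intro x
      rw [zfun_mul, zfun_mul, zfun_tau_inv, zfun_tau, zfun_s, zfun_sAff hr]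
      have := adj_shift r 0 x 1
      simp only [Fin.val_zero, Nat.cast_zero]
      rw [this]; ring
    rw [e, show w * (tau r * s ⟨0, hr⟩ * (tau r)⁻¹) = w * tau r * s ⟨0, hr⟩ * tau r ^ (-1 : ℤ) by
      rw [zpow_neg_one]; group, inversions_mul_tau_zpow]
    simpa only [inversions_mul_tau, zfun_mul, zfun_tau, Nat.cast_zero, zero_add, sub_self,
      Fin.val_zero] using h
  · have h := inversions_mul_s w i
    simpa [sAff] using h

/-- Without descents `w` acts as an increasing bijection of `ℤ`, and such a bijection is a
translation. -/
theorem exists_tau_zpow {r : ℕ} (w : W r)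
    (h : ∀ j : Fin (r + 1), zfun w ((j : ℕ) - 1) < zfun w (j : ℕ)) : ∃ m : ℤ, w = tau r ^ m := by
  have h1 : ∀ x, zfun w (x - 1) < zfun w x := by
    intro x
    obtain ⟨i, m, rfl⟩ := exists_eq_add_mul r x
    rw [add_sub_right_comm, zfun_add_period, zfun_add_period]
    have := h i
    omega
  have mono : StrictMono (zfun w) :=
    strictMono_int_of_lt_succ fun x => by simpa using h1 (x + 1)
  have h2 : ∀ x, zfun w (x - 1) = zfun w x - 1 := by
    intro x
    have hz := zfun_apply_inv w (zfun w x - 1)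
    set z := zfun w⁻¹ (zfun w x - 1)
    have h3 : z < x := mono.lt_iff_lt.1 (by omega)
    have h4 : zfun w z ≤ zfun w (x - 1) := mono.monotone (by omega)
    have := h1 x
    omega
  have h3 : ∀ x, zfun w x = zfun w 0 + x := by
    intro x
    induction x using Int.induction_on with
    | zero => ring
    | succ k ih => have := h2 (k + 1); rw [add_sub_cancel_right] at this; omega
    | pred k ih => rw [h2]; omega
  exact ⟨- zfun w 0, zfun_ext fun x => by rw [h3, zfun_tau_zpow]; ring⟩

theorem inversions_one (r : ℕ) : inversions r (zfun (1 : W r)) = 0 := by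
  simp only [inversions]
  refine Finset.sum_eq_zero fun i _ => Finset.sum_eq_zero fun j _ => ?_
  split_ifs with h
  · rw [zfun_one, zfun_one, Int.ediv_eq_zero_of_lt (by simp only [Fin.lt_def] at h; omega) (by omega)]
    rfl
  · rfl

/-- Bubble sort: each descent removed costs one letter and lowers the number of inversions by one,
until a power of `τ` is left. -/
theorem exists_word {r : ℕ} (hr : 1 ≤ r) (w : W r) :
    ∃ (l : List (Fin (r + 1))) (j : ℤ),
      l.length = inversions r (zfun w) ∧ w = (l.map sAff).prod * tau r ^ j := by
  induction hN : inversions r (zfun w) generalizing w with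
  | zero =>
    obtain ⟨m, hm⟩ := exists_tau_zpow w fun j => by
      by_contra h
      have := (inversions_mul_sAff hr w j).2 h
      omega
    exact ⟨[], m, rfl, by simpa using hm⟩
  | succ N ih =>
    obtain ⟨j, hj⟩ : ∃ j : Fin (r + 1), ¬ zfun w ((j : ℕ) - 1) < zfun w (j : ℕ) := by
      by_contra! h
      obtain ⟨m, rfl⟩ := exists_tau_zpow w h
      rw [← one_mul (tau r ^ m), inversions_mul_tau_zpow, inversions_one] at hN
      omega
    have := (inversions_mul_sAff hr w j).2 hj
    obtain ⟨l, m, hl, hw⟩ := ih (w * sAff j) (by omega)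
    -- The removed letter `s_j` becomes `s_{j-m}` when it is moved to the left of `τ ^ m`.
    refine ⟨l ++ [res r ((j : ℕ) - m)], m, by simp [hl], ?_⟩
    rw [List.map_append, List.prod_append, List.map_singleton, List.prod_singleton, mul_assoc,
      ← tau_zpow_mul_sAff hr, ← mul_assoc, ← hw, sAff_mul_cancel_right hr]

theorem inversions_le {r : ℕ} (hr : 1 ≤ r) (l : List (Fin (r + 1))) (j : ℤ) :
    inversions r (zfun ((l.map sAff).prod * tau r ^ j)) ≤ l.length := by
  rw [inversions_mul_tau_zpow]
  induction l using List.reverseRecOn with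
  | nil => simp [inversions_one]
  | append_singleton l a ih =>
    rw [List.map_append, List.prod_append, List.map_singleton, List.prod_singleton,
      List.length_append, List.length_singleton]
    by_cases h : zfun (l.map sAff).prod ((a : ℕ) - 1) < zfun (l.map sAff).prod (a : ℕ)
    · have := (inversions_mul_sAff hr _ a).1 h; omega
    · have := (inversions_mul_sAff hr _ a).2 h; omega

theorem len_eq_inversions {r : ℕ} (hr : 1 ≤ r) (w : W r) : len w = inversions r (zfun w) := by
  apply le_antisymm
  · obtain ⟨l, j, h1, h2⟩ := exists_word hr w
    exact Nat.sInf_le ⟨l, j, h1, h2⟩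
  · apply le_csInf
    · obtain ⟨l, j, h1, h2⟩ := exists_word hr w
      exact ⟨_, l, j, h1, h2⟩
    · rintro m ⟨l, j, rfl, rfl⟩
      exact inversions_le hr l j

theorem exists_reduced_word {r : ℕ} (hr : 1 ≤ r) (w : W r) :
    ∃ (l : List (Fin (r + 1))) (j : ℤ), l.length = len w ∧ w = (l.map sAff).prod * tau r ^ j := by
  rw [len_eq_inversions hr]; exact exists_word hr w

theorem len_word_le {r : ℕ} (l : List (Fin (r + 1))) (j : ℤ) :
    len ((l.map sAff).prod * tau r ^ j) ≤ l.length :=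
  Nat.sInf_le ⟨l, j, rfl, rfl⟩

theorem len_one (r : ℕ) : len (1 : W r) = 0 := by
  have := len_word_le (r := r) [] 0
  simpa using this

theorem len_mul_tau_zpow {r : ℕ} (hr : 1 ≤ r) (w : W r) (m : ℤ) : len (w * tau r ^ m) = len w := by
  rw [len_eq_inversions hr, len_eq_inversions hr, inversions_mul_tau_zpow]

theorem len_mul_sAff_of_lt {r : ℕ} (hr : 1 ≤ r) {w : W r} {j : Fin (r + 1)}
    (h : zfun w ((j : ℕ) - 1) < zfun w (j : ℕ)) : len (w * sAff j) = len w + 1 := by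
  rw [len_eq_inversions hr, len_eq_inversions hr, (inversions_mul_sAff hr w j).1 h]

theorem len_mul_sAff_of_not_lt {r : ℕ} (hr : 1 ≤ r) {w : W r} {j : Fin (r + 1)}
    (h : ¬ zfun w ((j : ℕ) - 1) < zfun w (j : ℕ)) : len (w * sAff j) + 1 = len w := by
  rw [len_eq_inversions hr, len_eq_inversions hr, (inversions_mul_sAff hr w j).2 h]

theorem len_lt_mul_sAff_iff {r : ℕ} (hr : 1 ≤ r) {w : W r} {j : Fin (r + 1)} :
    len w < len (w * sAff j) ↔ zfun w ((j : ℕ) - 1) < zfun w (j : ℕ) := by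
  by_cases h : zfun w ((j : ℕ) - 1) < zfun w (j : ℕ)
  · have := len_mul_sAff_of_lt hr h; simp [h]; omega
  · have := len_mul_sAff_of_not_lt hr h; simp only [h, iff_false]; omega

theorem len_mul_sAff {r : ℕ} (hr : 1 ≤ r) (w : W r) (j : Fin (r + 1)) :
    len (w * sAff j) = len w + 1 ∨ len (w * sAff j) + 1 = len w := by
  by_cases h : zfun w ((j : ℕ) - 1) < zfun w (j : ℕ)
  · exact Or.inl (len_mul_sAff_of_lt hr h)
  · exact Or.inr (len_mul_sAff_of_not_lt hr h)

/-- The inverse is the reversed word, with the power of `τ` moved back to the right end at the price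
of rotating the indices. -/
theorem len_inv_le {r : ℕ} (hr : 1 ≤ r) (w : W r) : len w⁻¹ ≤ len w := by
  obtain ⟨l, m, h1, h2⟩ := exists_reduced_word hr w
  have key : ∀ l : List (Fin (r + 1)), ∃ l' : List (Fin (r + 1)), l'.length = l.length ∧
      ((l.map sAff).prod * tau r ^ m)⁻¹ = (l'.map sAff).prod * tau r ^ (-m) := by
    intro l
    induction l using List.reverseRecOn with
    | nil => exact ⟨[], rfl, by simp⟩
    | append_singleton l a ih =>
      obtain ⟨l', h1, h2⟩ := ih
      refine ⟨res r ((a : ℕ) + m) :: l', by simp [h1], ?_⟩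
      rw [List.map_append, List.prod_append, List.map_singleton, List.prod_singleton, mul_assoc,
        sAff_mul_tau_zpow hr, ← mul_assoc, mul_inv_rev, h2, sAff_inv hr, List.map_cons,
        List.prod_cons, mul_assoc]
  obtain ⟨l', h3, h4⟩ := key l
  rw [← h1, ← h3]
  nth_rw 1 [h2]
  rw [h4]
  exact len_word_le _ _

theorem len_inv {r : ℕ} (hr : 1 ≤ r) (w : W r) : len w⁻¹ = len w := by
  apply le_antisymm (len_inv_le hr w)
  simpa using len_inv_le hr w⁻¹

theorem len_tau_zpow_mul {r : ℕ} (hr : 1 ≤ r) (w : W r) (m : ℤ) : len (tau r ^ m * w) = len w := by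
  rw [← len_inv hr, mul_inv_rev, ← zpow_neg, len_mul_tau_zpow hr, len_inv hr]

theorem len_tau_zpow {r : ℕ} (hr : 1 ≤ r) (m : ℤ) : len (tau r ^ m) = 0 := by
  rw [← one_mul (tau r ^ m), len_mul_tau_zpow hr, len_one]

theorem len_sAff_mul {r : ℕ} (hr : 1 ≤ r) (w : W r) (j : Fin (r + 1)) :
    len (sAff j * w) = len w + 1 ∨ len (sAff j * w) + 1 = len w := by
  rw [← len_inv hr (sAff j * w), mul_inv_rev, sAff_inv hr, ← len_inv hr w]
  exact len_mul_sAff hr w⁻¹ j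

theorem len_lt_sAff_mul_iff {r : ℕ} (hr : 1 ≤ r) {w : W r} {j : Fin (r + 1)} :
    len w < len (sAff j * w) ↔ zfun w⁻¹ ((j : ℕ) - 1) < zfun w⁻¹ (j : ℕ) := by
  rw [← len_inv hr (sAff j * w), mul_inv_rev, sAff_inv hr, ← len_inv hr w, len_lt_mul_sAff_iff hr]

theorem len_sAff {r : ℕ} (hr : 1 ≤ r) (j : Fin (r + 1)) : len (sAff j) = 1 := by
  rcases len_mul_sAff hr 1 j with h | h <;> rw [one_mul, len_one] at h <;> omega

theorem len_mul_le {r : ℕ} (hr : 1 ≤ r) (u w : W r) : len (u * w) ≤ len u + len w := by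
  obtain ⟨l, m, h1, h2⟩ := exists_reduced_word hr u
  rw [← h1, h2]
  clear h1 h2
  induction l with
  | nil => simp [len_tau_zpow_mul hr]
  | cons a l ih =>
    rw [List.map_cons, List.prod_cons, mul_assoc, mul_assoc, List.length_cons]
    rw [mul_assoc] at ih
    rcases len_sAff_mul hr ((l.map sAff).prod * (tau r ^ m * w)) a with h | h <;> omega

/-! ### The exchange condition and descents -/

/-- The exchange condition. -/
theorem exchange {r : ℕ} (hr : 1 ≤ r) {w : W r} {i j : Fin (r + 1)}
    (h1 : len w < len (sAff i * w)) (h2 : len (sAff i * (w * sAff j)) < len (w * sAff j)) :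
    sAff i * w = w * sAff j := by
  rw [len_lt_sAff_mul_iff hr] at h1
  have h3 : ¬ len (w * sAff j) < len (sAff i * (w * sAff j)) := by omega
  rw [len_lt_sAff_mul_iff hr, mul_inv_rev, sAff_inv hr, zfun_mul, zfun_mul, zfun_sAff hr,
    zfun_sAff hr] at h3
  -- `s_j` reverses the order of `w⁻¹ (i - 1) < w⁻¹ i`, so by `eq_of_adj_lt` these two integers are
  -- a common translate of `j - 1` and `j`. Thus `w` carries the classes exchanged by `s_j` to those
  -- exchanged by `s_i`.
  have h4 : adj r (j : ℕ) (zfun w⁻¹ (i : ℕ)) < adj r (j : ℕ) (zfun w⁻¹ ((i : ℕ) - 1)) := by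
    refine lt_of_le_of_ne (by omega) fun h => ?_
    have h' := congrArg (adj r (j : ℕ)) h
    rw [adj_adj hr, adj_adj hr] at h'
    omega
  obtain ⟨m, h5, h6⟩ := eq_of_adj_lt hr h1 h4
  have h7 : ((i : ℕ) : ℤ) - 1 = zfun w ((j : ℕ) - 1) + ((r : ℤ) + 1) * m := by
    rw [← zfun_add_period, ← h5, zfun_apply_inv]
  have h8 : ((i : ℕ) : ℤ) = zfun w (j : ℕ) + ((r : ℤ) + 1) * m := by
    rw [← zfun_add_period, ← h6, zfun_apply_inv]
  apply zfun_ext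
  intro x
  rw [zfun_mul, zfun_mul, zfun_sAff hr, zfun_sAff hr]
  rcases adj_eq_or r (j : ℕ) x with ⟨⟨l, h⟩, e⟩ | ⟨⟨l, h⟩, e⟩ | ⟨e, h, h'⟩
  · rw [e]
    have e1 : x = ((j : ℕ) : ℤ) + ((r : ℤ) + 1) * l := by linarith
    rw [e1, add_sub_right_comm, zfun_add_period, zfun_add_period, adj_add_period,
      show zfun w ((j : ℕ) : ℤ) = ((i : ℕ) : ℤ) + ((r : ℤ) + 1) * (-m) by linarith,
      adj_add_period, adj_left]
    linarith
  · rw [e]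
    have e1 : x = (((j : ℕ) : ℤ) - 1) + ((r : ℤ) + 1) * l := by linarith
    rw [e1, add_right_comm, sub_add_cancel, zfun_add_period, zfun_add_period, adj_add_period,
      show zfun w (((j : ℕ) : ℤ) - 1) = (((i : ℕ) : ℤ) - 1) + ((r : ℤ) + 1) * (-m) by linarith,
      adj_add_period, adj_right hr]
    linarith
  · rw [e]
    have k1 := zfun_sub_not_dvd w h
    have k2 := zfun_sub_not_dvd w h'
    rcases adj_eq_or r (i : ℕ) (zfun w x) with ⟨⟨l, g⟩, e⟩ | ⟨⟨l, g⟩, e⟩ | ⟨e, -⟩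
    · exact absurd ⟨l + m, by linarith⟩ k1
    · exact absurd ⟨l + m, by linarith⟩ k2
    · exact e

theorem eq_tau_zpow_of_len_eq_zero {r : ℕ} (hr : 1 ≤ r) {w : W r} (h : len w = 0) :
    ∃ m : ℤ, w = tau r ^ m := by
  obtain ⟨l, m, h1, h2⟩ := exists_reduced_word hr w
  rw [h, List.length_eq_zero_iff] at h1
  exact ⟨m, by simpa [h1] using h2⟩

theorem exists_right_descent {r : ℕ} (hr : 1 ≤ r) {w : W r} (h : len w ≠ 0) :
    ∃ j, len (w * sAff j) + 1 = len w := by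
  by_contra! h'
  obtain ⟨m, rfl⟩ := exists_tau_zpow w fun j => by
    rw [← len_lt_mul_sAff_iff hr]
    have := h' j
    have := len_mul_sAff hr w j
    omega
  exact h (len_tau_zpow hr m)

theorem exists_left_descent {r : ℕ} (hr : 1 ≤ r) {w : W r} (h : len w ≠ 0) :
    ∃ j, len (sAff j * w) + 1 = len w := by
  rw [← len_inv hr] at h
  obtain ⟨j, hj⟩ := exists_right_descent hr h
  refine ⟨j, ?_⟩
  rwa [← len_inv hr (sAff j * w), mul_inv_rev, sAff_inv hr, ← len_inv hr w]

/-! ### The regular representation and the independence of the `T_w` -/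

section Rep

variable {k : Type*} [Field k] (q : k) {r : ℕ}

open Classical in
/-- Left multiplication by `T_{s_i}` on the free module with basis `W`. -/
noncomputable def leftOp (i : Fin (r + 1)) : (W r →₀ k) →ₗ[k] (W r →₀ k) :=
  Finsupp.linearCombination k fun w =>
    if len w < len (sAff i * w) then Finsupp.single (sAff i * w) 1
    else q • Finsupp.single (sAff i * w) 1 + (q - 1) • Finsupp.single w 1

open Classical in
/-- Right multiplication by `T_{s_j}` on the free module with basis `W`. -/
noncomputable def rightOp (j : Fin (r + 1)) : (W r →₀ k) →ₗ[k] (W r →₀ k) :=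
  Finsupp.linearCombination k fun w =>
    if len w < len (w * sAff j) then Finsupp.single (w * sAff j) 1
    else q • Finsupp.single (w * sAff j) 1 + (q - 1) • Finsupp.single w 1

/-- Right multiplication by an element of `W` on the free module with basis `W`. -/
noncomputable def rightMul (k : Type*) [Field k] {r : ℕ} (g : W r) :
    (W r →₀ k) →ₗ[k] (W r →₀ k) :=
  Finsupp.lmapDomain k k fun w => w * g

/-- Left multiplication by an element of `W` on the free module with basis `W`. -/
noncomputable def leftMul (k : Type*) [Field k] {r : ℕ} (g : W r) :
    (W r →₀ k) →ₗ[k] (W r →₀ k) :=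
  Finsupp.lmapDomain k k fun w => g * w

theorem leftOp_single (i : Fin (r + 1)) (w : W r) : leftOp q i (Finsupp.single w 1) =
    if len w < len (sAff i * w) then Finsupp.single (sAff i * w) 1
    else q • Finsupp.single (sAff i * w) 1 + (q - 1) • Finsupp.single w 1 := by
  simp only [leftOp, Finsupp.linearCombination_single, one_smul]

theorem rightOp_single (i : Fin (r + 1)) (w : W r) : rightOp q i (Finsupp.single w 1) =
    if len w < len (w * sAff i) then Finsupp.single (w * sAff i) 1
    else q • Finsupp.single (w * sAff i) 1 + (q - 1) • Finsupp.single w 1 := by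
  simp only [rightOp, Finsupp.linearCombination_single, one_smul]

theorem rightMul_single (g w : W r) :
    rightMul k g (Finsupp.single w 1) = Finsupp.single (w * g) 1 := by
  simp [rightMul]

theorem leftMul_single (g w : W r) :
    leftMul k g (Finsupp.single w 1) = Finsupp.single (g * w) 1 := by
  simp [leftMul]

/-- If `s_i w = w s_j`, the two operators follow the same formula on `w` and on `s_i w`. Otherwise
the exchange condition shows that multiplication by `s_j` does not affect whether `s_i` lengthens,
and conversely, so that the two formulas do not interact. -/
theorem leftOp_rightOp (hr : 1 ≤ r) (i j : Fin (r + 1)) (x : W r →₀ k) :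
    leftOp q i (rightOp q j x) = rightOp q j (leftOp q i x) := by
  suffices h : leftOp q i ∘ₗ rightOp q j = rightOp q j ∘ₗ leftOp q i from LinearMap.congr_fun h x
  refine Finsupp.lhom_ext' fun w => LinearMap.ext_ring ?_
  simp only [LinearMap.comp_apply, Finsupp.lsingle_apply]
  have a1 := len_sAff_mul hr w i
  have a2 := len_mul_sAff hr w j
  by_cases heq : sAff i * w = w * sAff j
  · have e1 : sAff i * (w * sAff j) = w := by rw [← heq, sAff_mul_cancel_left hr]
    have e2 : w * sAff j * sAff j = w := sAff_mul_cancel_right hr j w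
    rw [rightOp_single, leftOp_single, heq]
    split_ifs <;> simp only [map_add, map_smul, leftOp_single, rightOp_single, heq, e1, e2]
  · have e3 : sAff i * w * sAff j = sAff i * (w * sAff j) := mul_assoc _ _ _
    have key1 : len w < len (sAff i * w) ↔ len (w * sAff j) < len (sAff i * (w * sAff j)) := by
      have a3 := len_sAff_mul hr (w * sAff j) i
      constructor
      · intro h
        by_contra h'
        exact heq (exchange hr h (by omega))
      · intro h
        by_contra h'
        apply heq
        have := exchange hr (w := w * sAff j) (i := i) (j := j) h (by
          rw [sAff_mul_cancel_right hr]; omega)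
        rw [sAff_mul_cancel_right hr] at this
        calc sAff i * w = sAff i * (sAff i * (w * sAff j)) := by rw [this]
          _ = w * sAff j := sAff_mul_cancel_left hr _ _
    have key2 : len w < len (w * sAff j) ↔ len (sAff i * w) < len (sAff i * (w * sAff j)) := by
      have a3 := len_sAff_mul hr (w * sAff j) i
      have a4 := len_mul_sAff hr (sAff i * w) j
      rw [e3] at a4
      omega
    rw [rightOp_single, leftOp_single]
    split_ifs with h1 h2 h2 <;>
      simp only [map_add, map_smul, leftOp_single, rightOp_single, e3, h1, h2, ← key1, ← key2,
        if_true, if_false, smul_add, smul_smul]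
    all_goals try module

theorem leftOp_rightMul (hr : 1 ≤ r) (i : Fin (r + 1)) (m : ℤ) (x : W r →₀ k) :
    leftOp q i (rightMul k (tau r ^ m) x) = rightMul k (tau r ^ m) (leftOp q i x) := by
  suffices h : leftOp q i ∘ₗ rightMul k (tau r ^ m) = rightMul k (tau r ^ m) ∘ₗ leftOp q i from
    LinearMap.congr_fun h x
  refine Finsupp.lhom_ext' fun w => LinearMap.ext_ring ?_
  simp only [LinearMap.comp_apply, Finsupp.lsingle_apply, rightMul_single, leftOp_single,
    ← mul_assoc, len_mul_tau_zpow hr]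
  split_ifs <;> simp only [map_add, map_smul, rightMul_single]

theorem leftMul_rightOp (hr : 1 ≤ r) (j : Fin (r + 1)) (m : ℤ) (x : W r →₀ k) :
    leftMul k (tau r ^ m) (rightOp q j x) = rightOp q j (leftMul k (tau r ^ m) x) := by
  suffices h : leftMul k (tau r ^ m) ∘ₗ rightOp q j = rightOp q j ∘ₗ leftMul k (tau r ^ m) from
    LinearMap.congr_fun h x
  refine Finsupp.lhom_ext' fun w => LinearMap.ext_ring ?_
  simp only [LinearMap.comp_apply, Finsupp.lsingle_apply, leftMul_single, rightOp_single,
    mul_assoc, len_tau_zpow_mul hr]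
  split_ifs <;> simp only [map_add, map_smul, leftMul_single]

theorem leftMul_rightMul (g h : W r) (x : W r →₀ k) :
    leftMul k g (rightMul k h x) = rightMul k h (leftMul k g x) := by
  suffices e : leftMul k g ∘ₗ rightMul k h = rightMul k h ∘ₗ leftMul k g from
    LinearMap.congr_fun e x
  refine Finsupp.lhom_ext' fun w => LinearMap.ext_ring ?_
  simp only [LinearMap.comp_apply, Finsupp.lsingle_apply, leftMul_single, rightMul_single,
    mul_assoc]

/-- Endomorphisms commuting with the right multiplications. -/
def CommutesRight (φ : (W r →₀ k) →ₗ[k] (W r →₀ k)) : Prop :=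
  (∀ j x, φ (rightOp q j x) = rightOp q j (φ x)) ∧
    ∀ (m : ℤ) x, φ (rightMul k (tau r ^ m) x) = rightMul k (tau r ^ m) (φ x)

variable {q}

theorem CommutesRight.comp {φ ψ : (W r →₀ k) →ₗ[k] (W r →₀ k)} (hφ : CommutesRight q φ)
    (hψ : CommutesRight q ψ) : CommutesRight q (φ ∘ₗ ψ) :=
  ⟨fun j x => by simp only [LinearMap.comp_apply, hψ.1, hφ.1],
    fun m x => by simp only [LinearMap.comp_apply, hψ.2, hφ.2]⟩

theorem CommutesRight.add {φ ψ : (W r →₀ k) →ₗ[k] (W r →₀ k)} (hφ : CommutesRight q φ)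
    (hψ : CommutesRight q ψ) : CommutesRight q (φ + ψ) :=
  ⟨fun j x => by simp only [LinearMap.add_apply, hψ.1, hφ.1, map_add],
    fun m x => by simp only [LinearMap.add_apply, hψ.2, hφ.2, map_add]⟩

theorem CommutesRight.smul_id (c : k) :
    CommutesRight (r := r) q (c • LinearMap.id) :=
  ⟨fun j x => by simp, fun m x => by simp⟩

/-- The right multiplications generate the free module from the vector at `1`: a reduced word of `w`
leads from `1` to `w` through elements of increasing length. Relations between left operators
therefore need checking at `1` only. -/
theorem CommutesRight.ext (hr : 1 ≤ r) {φ ψ : (W r →₀ k) →ₗ[k] (W r →₀ k)}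
    (hφ : CommutesRight q φ) (hψ : CommutesRight q ψ)
    (h : φ (Finsupp.single 1 1) = ψ (Finsupp.single 1 1)) : φ = ψ := by
  refine Finsupp.lhom_ext' fun w => LinearMap.ext_ring ?_
  simp only [LinearMap.comp_apply, Finsupp.lsingle_apply]
  induction hn : len w generalizing w with
  | zero =>
    obtain ⟨m, rfl⟩ := eq_tau_zpow_of_len_eq_zero hr hn
    have e : Finsupp.single (tau r ^ m) (1 : k) =
        rightMul k (tau r ^ m) (Finsupp.single 1 1) := by rw [rightMul_single, one_mul]
    rw [e, hφ.2, hψ.2, h]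
  | succ n ih =>
    obtain ⟨j, hj⟩ := exists_right_descent hr (w := w) (by omega)
    have e : Finsupp.single w (1 : k) = rightOp q j (Finsupp.single (w * sAff j) 1) := by
      rw [rightOp_single, sAff_mul_cancel_right hr, if_pos (by omega)]
    rw [e, hφ.1, hψ.1, ih _ (by omega)]

/-- The operator is a composite of left multiplications along a reduced word of `w`. The values at
all `y` with additive lengths are recorded because they yield the relation `T_x T_y = T_{xy}`;
independence of the word comes from `CommutesRight.ext`. -/
theorem exists_commutesRight (q : k) (hr : 1 ≤ r) (w : W r) :
    ∃ φ : (W r →₀ k) →ₗ[k] (W r →₀ k), CommutesRight q φ ∧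
      ∀ y, len (w * y) = len w + len y → φ (Finsupp.single y 1) = Finsupp.single (w * y) 1 := by
  induction hn : len w generalizing w with
  | zero =>
    obtain ⟨m, rfl⟩ := eq_tau_zpow_of_len_eq_zero hr hn
    exact ⟨leftMul k (tau r ^ m), ⟨fun j x => leftMul_rightOp q hr j m x,
      fun l x => leftMul_rightMul _ _ x⟩, fun y _ => leftMul_single _ _⟩
  | succ n ih =>
    obtain ⟨i, hi⟩ := exists_left_descent hr (w := w) (by omega)
    obtain ⟨φ, h1, h2⟩ := ih (sAff i * w) (by omega)
    refine ⟨leftOp q i ∘ₗ φ, CommutesRight.comp ⟨fun j x => leftOp_rightOp q hr i j x,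
      fun m x => leftOp_rightMul q hr i m x⟩ h1, fun y hy => ?_⟩
    have a1 := len_mul_le hr (sAff i * w) y
    have a2 := len_sAff_mul hr (sAff i * w * y) i
    rw [mul_assoc, sAff_mul_cancel_left hr, ← mul_assoc] at a2
    rw [LinearMap.comp_apply, h2 y (by omega), leftOp_single, mul_assoc, sAff_mul_cancel_left hr,
      if_pos (by rw [← mul_assoc]; omega)]

/-- The action of `T_w` on the free module with basis `W`. -/
noncomputable def opT (q : k) (hr : 1 ≤ r) (w : W r) : Module.End k (W r →₀ k) :=
  (exists_commutesRight q hr w).choose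

theorem opT_commutes (q : k) (hr : 1 ≤ r) (w : W r) : CommutesRight q (opT q hr w) :=
  (exists_commutesRight q hr w).choose_spec.1

theorem opT_single (q : k) (hr : 1 ≤ r) {w y : W r} (h : len (w * y) = len w + len y) :
    opT q hr w (Finsupp.single y 1) = Finsupp.single (w * y) 1 :=
  (exists_commutesRight q hr w).choose_spec.2 y h

theorem opT_single_one (q : k) (hr : 1 ≤ r) (w : W r) :
    opT q hr w (Finsupp.single 1 1) = Finsupp.single w 1 := by
  rw [opT_single, mul_one]
  rw [mul_one, len_one, add_zero]

theorem opT_sAff (q : k) (hr : 1 ≤ r) (i : Fin (r + 1)) : opT q hr (sAff i) = leftOp q i := by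
  refine (opT_commutes q hr _).ext hr ⟨fun j x => leftOp_rightOp q hr i j x,
      fun m x => leftOp_rightMul q hr i m x⟩ ?_
  rw [opT_single_one, leftOp_single, mul_one, if_pos]
  rw [len_sAff hr, len_one]; exact one_pos

/-- The regular representation of the Hecke algebra. -/
noncomputable def rep (q : k) (hr : 1 ≤ r) : Hecke q r →ₐ[k] Module.End k (W r →₀ k) :=
  RingQuot.liftAlgHom k ⟨FreeAlgebra.lift k (opT q hr), by
    intro a b h
    induction h with
    | one =>
      rw [FreeAlgebra.lift_ι_apply, map_one]
      refine (opT_commutes q hr _).ext hr ⟨fun j x => rfl, fun m x => rfl⟩ ?_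
      rw [opT_single_one]; rfl
    | mul x y h =>
      rw [map_mul, FreeAlgebra.lift_ι_apply, FreeAlgebra.lift_ι_apply, FreeAlgebra.lift_ι_apply]
      refine ((opT_commutes q hr _).comp (opT_commutes q hr _)).ext hr (opT_commutes q hr _) ?_
      rw [opT_single_one, LinearMap.comp_apply, opT_single_one, opT_single q hr h]
    | quad i =>
      simp only [map_mul, map_sub, map_add, map_zero, map_one, FreeAlgebra.lift_ι_apply,
        AlgHom.commutes, opT_sAff]
      have h1 : CommutesRight q (leftOp (r := r) q i) := ⟨fun j x => leftOp_rightOp q hr i j x,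
        fun m x => leftOp_rightMul q hr i m x⟩
      -- Both factors commute with the right multiplications, so the quadratic relation is a
      -- computation at the vector of `1`.
      have e : (leftOp q i + (-q) • LinearMap.id) ∘ₗ (leftOp q i + (1 : k) • LinearMap.id) = 0 := by
        refine ((h1.add (CommutesRight.smul_id _)).comp (h1.add (CommutesRight.smul_id _))).ext hr
          ⟨fun j x => by simp, fun m x => by simp⟩ ?_
        have e1 : len (1 : W r) < len (sAff (r := r) i) := by
          rw [len_sAff hr, len_one]; exact one_pos
        simp only [LinearMap.comp_apply, LinearMap.add_apply, LinearMap.smul_apply,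
          LinearMap.id_apply, map_add, map_smul, leftOp_single, mul_one, sAff_mul_self hr, e1,
          if_true, not_lt.2 e1.le, if_false, LinearMap.zero_apply]
        module
      rw [← e, Module.algebraMap_end_eq_smul_id, sub_eq_add_neg]
      ext1
      simp only [Module.End.mul_eq_comp, Module.End.one_eq_id, one_smul]
      congr 4
      exact (neg_smul q (LinearMap.id : (W r →₀ k) →ₗ[k] _)).symm⟩

theorem rep_T (q : k) (hr : 1 ≤ r) (w : W r) : rep q hr (T q w) = opT q hr w := by
  rw [T, rep]
  erw [RingQuot.liftAlgHom_mkAlgHom_apply]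
  rw [FreeAlgebra.lift_ι_apply]

/-- In the regular representation `T_w` sends the basis vector at `1` to the one at `w`. -/
theorem linearIndependent_T (q : k) (hr : 1 ≤ r) : LinearIndependent k (T q (r := r)) := by
  let f : Hecke q r →ₗ[k] (W r →₀ k) :=
    (LinearMap.applyₗ (Finsupp.single 1 1)) ∘ₗ (rep q hr).toLinearMap
  apply LinearIndependent.of_comp f
  have : f ∘ T q = fun w => Finsupp.single w (1 : k) := by
    funext w
    simp [f, rep_T, opT_single_one]
  rw [this]
  exact Finsupp.linearIndependent_single_one k (W r)

end Rep

/-! ### Multiplication rules and the basis `T_w` of the Hecke algebra -/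

section Mul

variable {k : Type*} [Field k] (q : k) {r : ℕ}

/-- The projection from the free algebra to the Hecke algebra. -/
noncomputable def mkHecke : FreeAlgebra k (W r) →ₐ[k] Hecke q r :=
  RingQuot.mkAlgHom k (HeckeRel q r)

theorem T_one : T q (1 : W r) = 1 := by
  have h := RingQuot.mkAlgHom_rel k (HeckeRel.one (q := q) (r := r))
  rw [map_one] at h
  exact h

theorem T_mul {x y : W r} (h : len (x * y) = len x + len y) : T q x * T q y = T q (x * y) := by
  have h := RingQuot.mkAlgHom_rel k (HeckeRel.mul (q := q) (r := r) x y h)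
  rw [map_mul] at h
  exact h

theorem T_sAff_mul_self (i : Fin (r + 1)) :
    T q (sAff i) * T q (sAff i) = q • (1 : Hecke q r) + (q - 1) • T q (sAff i) := by
  have h := RingQuot.mkAlgHom_rel k (HeckeRel.quad (q := q) (r := r) i)
  simp only [map_mul, map_sub, map_add, map_zero, map_one, AlgHom.commutes] at h
  have h' : (T q (sAff i) - algebraMap k (Hecke q r) q) * (T q (sAff i) + 1) = 0 := h
  rw [Algebra.algebraMap_eq_smul_one, sub_mul, mul_add, mul_one, smul_mul_assoc, one_mul,
    smul_add] at h'
  rw [← sub_eq_zero, ← h']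
  module

theorem T_sAff_mul_of_lt (hr : 1 ≤ r) {i : Fin (r + 1)} {w : W r} (h : len w < len (sAff i * w)) :
    T q (sAff i) * T q w = T q (sAff i * w) := by
  apply T_mul
  have := len_sAff_mul hr w i
  rw [len_sAff hr]; omega

theorem T_sAff_mul_of_not_lt (hr : 1 ≤ r) {i : Fin (r + 1)} {w : W r}
    (h : ¬ len w < len (sAff i * w)) :
    T q (sAff i) * T q w = q • T q (sAff i * w) + (q - 1) • T q w := by
  have h1 := T_sAff_mul_of_lt q hr (i := i) (w := sAff i * w) (by
    have := len_sAff_mul hr w i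
    rw [sAff_mul_cancel_left hr]; omega)
  rw [sAff_mul_cancel_left hr] at h1
  nth_rw 1 [← h1]
  rw [← mul_assoc, T_sAff_mul_self, add_mul, smul_mul_assoc, one_mul, smul_mul_assoc, h1]

/-- The span contains `1` and is stable under left multiplication by the generators: for `T_{s_i}`
and powers of `τ` by the explicit rules, for general `T_w` by induction on the length. -/
theorem span_T (hr : 1 ≤ r) : Submodule.span k (Set.range (T q (r := r))) = ⊤ := by
  set S := Submodule.span k (Set.range (T q (r := r)))
  have hT : ∀ w, T q w ∈ S := fun w => Submodule.subset_span ⟨w, rfl⟩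
  have h1 : ∀ (w : W r), ∀ x ∈ S, T q w * x ∈ S := by
    intro w
    induction hn : len w generalizing w with
    | zero =>
      intro x hx
      obtain ⟨m, rfl⟩ := eq_tau_zpow_of_len_eq_zero hr hn
      induction hx using Submodule.span_induction with
      | mem x hx =>
        obtain ⟨y, rfl⟩ := hx
        rw [T_mul q (by rw [len_tau_zpow_mul hr, len_tau_zpow hr, zero_add])]
        exact hT _
      | zero => rw [mul_zero]; exact S.zero_mem
      | add x y _ _ hx hy => rw [mul_add]; exact S.add_mem hx hy
      | smul c x _ hx => rw [mul_smul_comm]; exact S.smul_mem _ hx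
    | succ n ih =>
      intro x hx
      obtain ⟨i, hi⟩ := exists_left_descent hr (w := w) (by omega)
      have e := T_sAff_mul_of_lt q hr (i := i) (w := sAff i * w) (by
        rw [sAff_mul_cancel_left hr]; omega)
      rw [sAff_mul_cancel_left hr] at e
      rw [← e, mul_assoc]
      have hy := ih (sAff i * w) (by omega) x hx
      generalize T q (sAff i * w) * x = y at hy
      induction hy using Submodule.span_induction with
      | mem x hx =>
        obtain ⟨y, rfl⟩ := hx
        by_cases h : len y < len (sAff i * y)
        · rw [T_sAff_mul_of_lt q hr h]; exact hT _
        · rw [T_sAff_mul_of_not_lt q hr h]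
          exact S.add_mem (S.smul_mem _ (hT _)) (S.smul_mem _ (hT _))
      | zero => rw [mul_zero]; exact S.zero_mem
      | add x y _ _ hx hy => rw [mul_add]; exact S.add_mem hx hy
      | smul c x _ hx => rw [mul_smul_comm]; exact S.smul_mem _ hx
  have h2 : ∀ x : FreeAlgebra k (W r), ∀ y ∈ S, mkHecke q x * y ∈ S := by
    intro x
    induction x using FreeAlgebra.induction with
    | grade0 c =>
      intro y hy
      rw [AlgHom.commutes, ← Algebra.smul_def]
      exact S.smul_mem _ hy
    | grade1 w => exact h1 w
    | mul a b ha hb =>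
      intro y hy
      rw [map_mul, mul_assoc]
      exact ha _ (hb _ hy)
    | add a b ha hb =>
      intro y hy
      rw [map_add, add_mul]
      exact S.add_mem (ha _ hy) (hb _ hy)
  rw [eq_top_iff]
  intro z _
  obtain ⟨x, rfl⟩ := RingQuot.mkAlgHom_surjective k (HeckeRel q r) z
  have h3 := h2 x 1 (by rw [← T_one q]; exact hT 1)
  rwa [mul_one] at h3

/-- The basis `T_w` of the Hecke algebra. -/
noncomputable def basisT (hr : 1 ≤ r) : Module.Basis (W r) k (Hecke q r) :=
  Module.Basis.mk (linearIndependent_T q hr) (span_T q hr).ge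

theorem basisT_apply (hr : 1 ≤ r) (w : W r) : basisT q hr w = T q w := by
  rw [basisT, Module.Basis.mk_apply]

theorem repr_T (hr : 1 ≤ r) (w : W r) : (basisT q hr).repr (T q w) = Finsupp.single w 1 := by
  rw [← basisT_apply q hr, Module.Basis.repr_self]

end Mul

/-! ### Reduced words in finite parabolic subgroups -/

section Combinatorics

variable {r : ℕ}

theorem sAff_succ (i : Fin r) : sAff i.succ = s i := rfl

theorem s_mul_self (i : Fin r) : s i * s i = 1 := by
  rw [s, perm, ← map_mul, Equiv.swap_mul_self, map_one]

theorem s_inv (i : Fin r) : (s i)⁻¹ = s i := inv_eq_of_mul_eq_one_left (s_mul_self i)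

theorem perm_injective : Function.Injective (perm (r := r)) := SemidirectProduct.inr_injective

theorem perm_mul (σ ρ : Equiv.Perm (Fin (r + 1))) : perm (σ * ρ) = perm σ * perm ρ := map_mul _ _ _

theorem perm_inv (σ : Equiv.Perm (Fin (r + 1))) : perm σ⁻¹ = (perm σ)⁻¹ := map_inv _ _

theorem s_injective : Function.Injective (s (r := r)) := by
  intro i j h
  have h1 := congrArg (fun σ => σ i.castSucc) (perm_injective h)
  simp only [Equiv.swap_apply_left, Equiv.swap_apply_def] at h1
  apply Fin.ext
  split_ifs at h1 with h2 h3 <;>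
    simp only [Fin.ext_iff, Fin.val_succ, Fin.val_castSucc] at * <;> omega

theorem s_mem_parabolic {J : Finset (Fin r)} {i : Fin r} (hi : i ∈ J) : s i ∈ parabolic J :=
  Subgroup.subset_closure ⟨i, hi, rfl⟩

theorem parabolic_mono {J K : Finset (Fin r)} (h : J ⊆ K) : parabolic J ≤ parabolic K :=
  Subgroup.closure_mono (Set.image_mono h)

theorem parabolic_empty : parabolic (∅ : Finset (Fin r)) = ⊥ := by
  simp [parabolic]

theorem word_mem_parabolic {J : Finset (Fin r)} {l : List (Fin r)} (h : ∀ i ∈ l, i ∈ J) :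
    (l.map s).prod ∈ parabolic J := by
  apply Subgroup.list_prod_mem
  intro x hx
  obtain ⟨i, hi, rfl⟩ := List.mem_map.1 hx
  exact s_mem_parabolic (h i hi)

/-- If left multiplication by a simple reflection lengthens `g` but shortens `g` times a word,
then it amounts to the omission of one letter of the word. -/
theorem omit_letter (hr : 1 ≤ r) {i : Fin (r + 1)} {g : W r} {l : List (Fin (r + 1))}
    (h1 : len g < len (sAff i * g))
    (h2 : len (sAff i * (g * (l.map sAff).prod)) < len (g * (l.map sAff).prod)) :
    ∃ l' : List (Fin (r + 1)), l'.Sublist l ∧ l'.length + 1 = l.length ∧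
      sAff i * (g * (l.map sAff).prod) = g * (l'.map sAff).prod := by
  induction l generalizing g with
  | nil => simp only [List.map_nil, List.prod_nil, mul_one] at h2; omega
  | cons a l ih =>
    rw [List.map_cons, List.prod_cons, ← mul_assoc g] at h2 ⊢
    -- Either the first letter already causes the descent, and then `s_i g = g s_a` cancels it, or
    -- the letter is absorbed into `g`.
    by_cases h3 : len (sAff i * (g * sAff a)) < len (g * sAff a)
    · have e := exchange hr h1 h3
      refine ⟨l, List.sublist_cons_self a l, by simp, ?_⟩
      rw [← mul_assoc, ← mul_assoc, e, sAff_mul_cancel_right hr]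
    · have h4 := len_sAff_mul hr (g * sAff a) i
      obtain ⟨l', h5, h6, h7⟩ := ih (g := g * sAff a) (by omega) h2
      refine ⟨a :: l', h5.cons_cons a, by simp [h6], ?_⟩
      rw [h7, List.map_cons, List.prod_cons, mul_assoc]

theorem len_word_s_le (l : List (Fin r)) : len (l.map s).prod ≤ l.length := by
  have h := len_word_le (l.map Fin.succ) 0
  simpa [List.map_map, Function.comp_def, sAff_succ] using h

theorem map_s (l : List (Fin r)) : l.map s = (l.map Fin.succ).map sAff := by
  rw [List.map_map]; rfl

theorem omit_letter_s (hr : 1 ≤ r) {i : Fin (r + 1)} {g : W r} {l : List (Fin r)}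
    (h1 : len g < len (sAff i * g))
    (h2 : len (sAff i * (g * (l.map s).prod)) < len (g * (l.map s).prod)) :
    ∃ l' : List (Fin r), l'.Sublist l ∧ l'.length + 1 = l.length ∧
      sAff i * (g * (l.map s).prod) = g * (l'.map s).prod := by
  rw [map_s] at h2 ⊢
  obtain ⟨l', h3, h4, h5⟩ := omit_letter hr h1 h2
  obtain ⟨l'', h6, rfl⟩ := List.sublist_map_iff.1 h3
  exact ⟨l'', h6, by simpa using h4, by rw [h5, map_s]⟩

/-- The length in `W` of an element of `W_J` is its length in the generators `J`. When `s_i` with `i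
∈ J` multiplies a reduced word in `J`, it is either prepended or, by `omit_letter_s`, removes a
letter, so no other generator ever enters. -/
theorem exists_parabolic_word (hr : 1 ≤ r) {J : Finset (Fin r)} {x : W r} (hx : x ∈ parabolic J) :
    ∃ l : List (Fin r), (∀ i ∈ l, i ∈ J) ∧ l.length = len x ∧ x = (l.map s).prod := by
  have step : ∀ i ∈ J, ∀ y : W r,
      (∃ l : List (Fin r), (∀ i ∈ l, i ∈ J) ∧ l.length = len y ∧ y = (l.map s).prod) →
      ∃ l : List (Fin r), (∀ i ∈ l, i ∈ J) ∧ l.length = len (s i * y) ∧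
        s i * y = (l.map s).prod := by
    rintro i hi y ⟨l, h1, h2, h3⟩
    have h4 := len_sAff_mul hr y i.succ
    rw [sAff_succ] at h4
    by_cases h5 : len y < len (s i * y)
    · refine ⟨i :: l, ?_, ?_, ?_⟩
      · simpa [hi] using h1
      · rw [List.length_cons]; omega
      · rw [List.map_cons, List.prod_cons, ← h3]
    · obtain ⟨l', h6, h7, h8⟩ := omit_letter_s hr (i := i.succ) (g := 1) (l := l)
        (by rw [mul_one, len_one, len_sAff hr]; exact one_pos)
        (by rw [one_mul, ← h3, sAff_succ]; omega)
      rw [one_mul, one_mul, ← h3, sAff_succ] at h8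
      exact ⟨l', fun j hj => h1 j (h6.subset hj), by omega, h8⟩
  induction hx using Subgroup.closure_induction_left with
  | one => exact ⟨[], by simp, by simp [len_one], by simp⟩
  | mul_left x hx y hy ih =>
    obtain ⟨i, hi, rfl⟩ := hx
    exact step i hi y ih
  | inv_mul_cancel x hx y hy ih =>
    obtain ⟨i, hi, rfl⟩ := hx
    rw [s_inv]
    exact step i hi y ih

theorem eq_one_of_len_eq_zero (hr : 1 ≤ r) {J : Finset (Fin r)} {x : W r} (hx : x ∈ parabolic J)
    (h : len x = 0) : x = 1 := by
  obtain ⟨l, h1, h2, h3⟩ := exists_parabolic_word hr hx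
  rw [h, List.length_eq_zero_iff] at h2
  rw [h3, h2]; rfl

theorem exists_parabolic_left_descent (hr : 1 ≤ r) {J : Finset (Fin r)} {x : W r}
    (hx : x ∈ parabolic J) (h : x ≠ 1) :
    ∃ i ∈ J, ∃ y ∈ parabolic J, x = s i * y ∧ len x = len y + 1 := by
  obtain ⟨l, h1, h2, h3⟩ := exists_parabolic_word hr hx
  cases l with
  | nil => exact absurd h3 h
  | cons i l =>
    have hy : (l.map s).prod ∈ parabolic J :=
      word_mem_parabolic fun j hj => h1 j (List.mem_cons_of_mem i hj)
    refine ⟨i, h1 i List.mem_cons_self, _, hy, by rw [h3, List.map_cons, List.prod_cons], ?_⟩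
    have h4 := len_sAff_mul hr (l.map s).prod i.succ
    rw [sAff_succ, ← List.prod_cons, ← List.map_cons, ← h3] at h4
    have := len_word_s_le l
    rw [List.length_cons] at h2
    omega

theorem exists_parabolic_right_descent (hr : 1 ≤ r) {J : Finset (Fin r)} {x : W r}
    (hx : x ∈ parabolic J) (h : x ≠ 1) :
    ∃ i ∈ J, ∃ y ∈ parabolic J, x = y * s i ∧ len x = len y + 1 := by
  obtain ⟨i, hi, y, hy, h1, h2⟩ := exists_parabolic_left_descent hr (inv_mem hx) (inv_ne_one.2 h)
  refine ⟨i, hi, y⁻¹, inv_mem hy, ?_, ?_⟩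
  · rw [← inv_inv x, h1, mul_inv_rev, s_inv]
  · rw [len_inv hr] at h2 ⊢; exact h2

/-! ### Minimal coset representatives and double cosets -/

/-- Elements of minimal length in their left coset `W_K g`. -/
def LeftMin (K : Finset (Fin r)) (g : W r) : Prop := ∀ x ∈ parabolic K, len g ≤ len (x * g)

/-- Elements of minimal length in their right coset `g W_K`. -/
def RightMin (K : Finset (Fin r)) (g : W r) : Prop := ∀ x ∈ parabolic K, len g ≤ len (g * x)

/-- If a letter `s_i` shortened `y g` while lengthening `y`, a letter of a reduced word of `g` could
be omitted: `s_i y g = y g'` with `g'` shorter than `g`. But `g' = y⁻¹ s_i y g` lies in `W_K g`,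
against minimality. -/
theorem LeftMin.len_mul (hr : 1 ≤ r) {K : Finset (Fin r)} {g : W r} (hg : LeftMin K g) {x : W r}
    (hx : x ∈ parabolic K) : len (x * g) = len x + len g := by
  induction hn : len x generalizing x with
  | zero => rw [eq_one_of_len_eq_zero hr hx hn, one_mul, zero_add]
  | succ n ih =>
    obtain ⟨i, hi, y, hy, rfl, h1⟩ := exists_parabolic_left_descent hr hx (by
      rintro rfl; rw [len_one] at hn; omega)
    have h2 := ih hy (by omega)
    have h3 := len_sAff_mul hr (y * g) i.succ
    rw [sAff_succ, ← mul_assoc] at h3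
    by_contra hne
    obtain ⟨l, m, h4, h5⟩ := exists_reduced_word hr g
    have e1 : ∀ u, u * g = u * (l.map sAff).prod * tau r ^ m := fun u => by rw [mul_assoc, ← h5]
    obtain ⟨l', -, h7, h8⟩ := omit_letter hr (i := i.succ) (g := y) (l := l)
      (by rw [sAff_succ]; omega) (by
        rw [← len_mul_tau_zpow hr _ m, ← len_mul_tau_zpow hr (y * _) m, ← e1, sAff_succ,
          ← mul_assoc, ← e1]; omega)
    have e2 : (l'.map sAff).prod * tau r ^ m = (y⁻¹ * s i * y) * g := by
      rw [e1, mul_assoc (y⁻¹ * s i), mul_assoc y⁻¹, ← sAff_succ, h8, inv_mul_cancel_left]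
    have h9 := hg (y⁻¹ * s i * y) (mul_mem (mul_mem (inv_mem hy) (s_mem_parabolic hi)) hy)
    rw [← e2] at h9
    have := len_word_le l' m
    omega

theorem rightMin_iff (hr : 1 ≤ r) {K : Finset (Fin r)} {g : W r} :
    RightMin K g ↔ LeftMin K g⁻¹ := by
  constructor
  · intro h x hx
    have := h x⁻¹ (inv_mem hx)
    rwa [← len_inv hr, ← len_inv hr (g * _), mul_inv_rev, inv_inv] at this
  · intro h x hx
    have := h x⁻¹ (inv_mem hx)
    rwa [← mul_inv_rev, len_inv hr, len_inv hr] at this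

theorem RightMin.len_mul (hr : 1 ≤ r) {K : Finset (Fin r)} {g : W r} (hg : RightMin K g) {x : W r}
    (hx : x ∈ parabolic K) : len (g * x) = len g + len x := by
  have := ((rightMin_iff hr).1 hg).len_mul hr (inv_mem hx)
  rwa [← mul_inv_rev, len_inv hr, len_inv hr, len_inv hr, add_comm (len x)] at this

theorem LeftMin.eq_of_mem (hr : 1 ≤ r) {K : Finset (Fin r)} {g h : W r} (hg : LeftMin K g)
    (hh : LeftMin K h) {x : W r} (hx : x ∈ parabolic K) (e : h = x * g) : h = g := by
  have h1 := hg.len_mul hr hx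
  have h2 := hh x⁻¹ (inv_mem hx)
  rw [e, inv_mul_cancel_left, h1] at h2
  rw [e, eq_one_of_len_eq_zero hr hx (by omega), one_mul]

theorem RightMin.eq_of_mem (hr : 1 ≤ r) {K : Finset (Fin r)} {g h : W r} (hg : RightMin K g)
    (hh : RightMin K h) {x : W r} (hx : x ∈ parabolic K) (e : h = g * x) : h = g := by
  have := LeftMin.eq_of_mem hr ((rightMin_iff hr).1 hg) ((rightMin_iff hr).1 hh) (inv_mem hx)
    (by rw [e, mul_inv_rev])
  exact inv_injective this

theorem exists_leftMin (K : Finset (Fin r)) (g : W r) :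
    ∃ x ∈ parabolic K, LeftMin K (x * g) := by
  obtain ⟨x, hx, h⟩ := Set.exists_min_image _ (fun x => len (x * g)) (parabolic_finite K)
    ⟨1, (parabolic K).one_mem⟩
  refine ⟨x, hx, fun y hy => ?_⟩
  rw [← mul_assoc]
  exact h _ (mul_mem hy hx)

theorem exists_rightMin (K : Finset (Fin r)) (g : W r) :
    ∃ x ∈ parabolic K, RightMin K (g * x) := by
  obtain ⟨x, hx, h⟩ := Set.exists_min_image _ (fun x => len (g * x)) (parabolic_finite K)
    ⟨1, (parabolic K).one_mem⟩
  refine ⟨x, hx, fun y hy => ?_⟩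
  rw [mul_assoc]
  exact h _ (mul_mem hx hy)

theorem mem_dcoset_self (K J : Finset (Fin r)) (d : W r) : d ∈ dcoset K J d :=
  ⟨1, one_mem _, 1, one_mem _, by simp⟩

theorem mul_mem_dcoset {K J : Finset (Fin r)} {d u x y : W r} (hx : x ∈ parabolic K)
    (hy : y ∈ parabolic J) (hu : u ∈ dcoset K J d) : x * u * y ∈ dcoset K J d := by
  obtain ⟨a, ha, b, hb, rfl⟩ := hu
  exact ⟨x * a, mul_mem hx ha, b * y, mul_mem hb hy, by simp only [mul_assoc]⟩

theorem dcoset_eq {K J : Finset (Fin r)} {d u : W r} (hu : u ∈ dcoset K J d) :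
    dcoset K J u = dcoset K J d := by
  obtain ⟨a, ha, b, hb, rfl⟩ := hu
  ext z
  constructor
  · rintro ⟨x, hx, y, hy, rfl⟩
    exact ⟨x * a, mul_mem hx ha, b * y, mul_mem hb hy, by simp only [mul_assoc]⟩
  · rintro ⟨x, hx, y, hy, rfl⟩
    exact ⟨x * a⁻¹, mul_mem hx (inv_mem ha), b⁻¹ * y, mul_mem (inv_mem hb) hy, by group⟩

theorem mem_dcoset_symm {K J : Finset (Fin r)} {d u : W r} (hu : u ∈ dcoset K J d) :
    d ∈ dcoset K J u := by
  rw [dcoset_eq hu]; exact mem_dcoset_self K J d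

theorem mul_left_mem_dcoset_iff {K J : Finset (Fin r)} {d u x : W r} (hx : x ∈ parabolic K) :
    x * u ∈ dcoset K J d ↔ u ∈ dcoset K J d := by
  constructor
  · intro h
    have := mul_mem_dcoset (inv_mem hx) (one_mem _) h
    rwa [mul_one, inv_mul_cancel_left] at this
  · intro h
    have := mul_mem_dcoset hx (one_mem _) h
    rwa [mul_one] at this

theorem mul_right_mem_dcoset_iff {K J : Finset (Fin r)} {d u y : W r} (hy : y ∈ parabolic J) :
    u * y ∈ dcoset K J d ↔ u ∈ dcoset K J d := by
  constructor
  · intro h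
    have := mul_mem_dcoset (one_mem _) (inv_mem hy) h
    rwa [one_mul, mul_inv_cancel_right] at this
  · intro h
    have := mul_mem_dcoset (one_mem _) hy h
    rwa [one_mul] at this

/-! ### Shortest double coset representatives in the symmetric group -/

section Shortest

variable {K J : Finset (Fin r)} {w : Equiv.Perm (Fin (r + 1))}

theorem leftMin_of_shortest (hw : w ∈ shortest K J) : LeftMin K (perm w) := fun x hx =>
  hw _ ⟨x, hx, 1, one_mem _, by simp⟩

theorem rightMin_of_shortest (hw : w ∈ shortest K J) : RightMin J (perm w) := fun y hy =>
  hw _ ⟨1, one_mem _, y, hy, by simp⟩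

/-- The decomposition is not unique, so the factors may have to be changed: a letter multiplied on
the left is absorbed into `u`, unless it lengthens `u` and shortens the whole. In that case it also
lengthens `u w`, and so it deletes a letter of `z`. -/
theorem exists_reduced_decomposition (hr : 1 ≤ r) (hw : w ∈ shortest K J) {x y : W r}
    (hx : x ∈ parabolic K) (hy : y ∈ parabolic J) :
    ∃ u ∈ parabolic K, ∃ z ∈ parabolic J, x * perm w * y = u * perm w * z ∧
      len (u * perm w * z) = len u + len (perm w) + len z := by
  induction hn : len x generalizing x with
  | zero =>
    refine ⟨1, one_mem _, y, hy, by rw [eq_one_of_len_eq_zero hr hx hn], ?_⟩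
    rw [one_mul, (rightMin_of_shortest hw).len_mul hr hy, len_one, zero_add]
  | succ n ih =>
    obtain ⟨i, hi, x', hx', rfl, h1⟩ := exists_parabolic_left_descent hr hx (by
      rintro rfl; rw [len_one] at hn; omega)
    obtain ⟨u, hu, z, hz, h2, h3⟩ := ih hx' (by omega)
    have hs := s_mem_parabolic hi
    have e : s i * x' * perm w * y = s i * (u * perm w * z) := by rw [← h2]; group
    have h4 := len_sAff_mul hr (u * perm w * z) i.succ
    have h5 := len_sAff_mul hr u i.succ
    rw [sAff_succ] at h4 h5
    have e' : s i * (u * perm w * z) = s i * u * perm w * z := by group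
    have h6 := len_mul_le hr (s i * u * perm w) z
    have h7 := (leftMin_of_shortest hw).len_mul hr (mul_mem hs hu)
    have h8 := (leftMin_of_shortest hw).len_mul hr hu
    by_cases hlt : len u < len (s i * u) ∧ len (s i * (u * perm w * z)) < len (u * perm w * z)
    · obtain ⟨l, hl1, hl2, hl3⟩ := exists_parabolic_word hr hz
      have g1 := hlt.2
      rw [hl3] at g1
      obtain ⟨l', g2, g3, g4⟩ := omit_letter_s hr (i := i.succ) (g := u * perm w)
        (by rw [sAff_succ, ← mul_assoc]; omega) (by rw [sAff_succ]; exact g1)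
      rw [← hl3, sAff_succ] at g4
      refine ⟨u, hu, (l'.map s).prod, word_mem_parabolic fun j hj => hl1 j (g2.subset hj),
        by rw [e, g4], ?_⟩
      have g5 := len_word_s_le l'
      have g6 := len_mul_le hr (u * perm w) (l'.map s).prod
      rw [g4] at h4
      omega
    · refine ⟨s i * u, mul_mem hs hu, z, hz, by rw [e, e'], ?_⟩
      rw [e'] at h4 hlt
      have := len_mul_le hr (s i * u * perm w) z
      omega

theorem shortest_unique (hr : 1 ≤ r) {w' : Equiv.Perm (Fin (r + 1))} (hw : w ∈ shortest K J)
    (hw' : w' ∈ shortest K J) (h : perm w' ∈ dcoset K J (perm w)) : w' = w := by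
  have h1 := hw' _ (mem_dcoset_symm h)
  obtain ⟨x, hx, y, hy, e⟩ := h
  obtain ⟨u, hu, z, hz, h2, h3⟩ := exists_reduced_decomposition hr hw hx hy
  rw [← h2, ← e] at h3
  rw [eq_one_of_len_eq_zero hr hu (by omega), eq_one_of_len_eq_zero hr hz (by omega), one_mul,
    mul_one, ← e] at h2
  exact perm_injective h2

theorem mem_meet_iff {K₁ K₂ : Finset (Fin r)} {i : Fin r} :
    i ∈ meet K₁ K₂ w ↔ i ∈ K₁ ∧ ∃ j ∈ K₂, perm w * s i * (perm w)⁻¹ = s j := by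
  simp [meet]

theorem mem_conj_iff {j : Fin r} :
    j ∈ conj w J ↔ ∃ i ∈ J, perm w * s i * (perm w)⁻¹ = s j := by
  simp [conj]

theorem meet_subset (K₁ K₂ : Finset (Fin r)) (w : Equiv.Perm (Fin (r + 1))) :
    meet K₁ K₂ w ⊆ K₁ := fun _ hi => (mem_meet_iff.1 hi).1

theorem conj_meet_subset (K₁ K₂ : Finset (Fin r)) (w : Equiv.Perm (Fin (r + 1))) :
    conj w (meet K₁ K₂ w) ⊆ K₂ := by
  intro j hj
  obtain ⟨i, hi, h⟩ := mem_conj_iff.1 hj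
  obtain ⟨-, j', hj', h'⟩ := mem_meet_iff.1 hi
  rwa [← s_injective (h'.symm.trans h)]

/-- The intersection `W_{K₁} ∩ w⁻¹ W_{K₂} w` is the parabolic subgroup of `K₁ ∩ w⁻¹ K₂`. -/
theorem mem_parabolic_meet (hr : 1 ≤ r) {K₁ K₂ : Finset (Fin r)} (hw : w ∈ shortest K₂ K₁) {y : W r}
    (hy : y ∈ parabolic K₁) (h : perm w * y * (perm w)⁻¹ ∈ parabolic K₂) :
    y ∈ parabolic (meet K₁ K₂ w) := by
  induction hn : len y generalizing y with
  | zero => rw [eq_one_of_len_eq_zero hr hy hn]; exact one_mem _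
  | succ n ih =>
    obtain ⟨a, ha, y', hy', rfl, h1⟩ := exists_parabolic_right_descent hr hy (by
      rintro rfl; rw [len_one] at hn; omega)
    set x := perm w * (y' * s a) * (perm w)⁻¹ with hx
    have hsa := s_mem_parabolic ha
    obtain ⟨l, hl1, hl2, hl3⟩ := exists_parabolic_word hr (inv_mem h)
    have b1 := (rightMin_of_shortest hw).len_mul hr hy'
    have b2 := (rightMin_of_shortest hw).len_mul hr hy
    have b3 := (rightMin_of_shortest hw).len_mul hr hsa
    have b4 : len (s a) = 1 := len_sAff hr a.succ
    have e1 : (perm w)⁻¹ * x⁻¹ = (perm w * (y' * s a))⁻¹ := by rw [hx]; group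
    have e2 : s a * ((perm w)⁻¹ * x⁻¹) = (perm w * y')⁻¹ := by rw [e1]; group
    -- With `y = y' s_a` one has `(w y)⁻¹ = w⁻¹ x⁻¹`. The reflection `s_a` shortens this element but
    -- lengthens `w⁻¹`, so it omits a letter of the word of `x⁻¹` in `K₂`. Hence `w s_a w⁻¹` lies in
    -- `W_{K₂}`.
    obtain ⟨l', g2, g3, g4⟩ := omit_letter_s hr (i := a.succ) (g := (perm w)⁻¹) (l := l)
      (by
        have : s a * (perm w)⁻¹ = (perm w * s a)⁻¹ := by rw [mul_inv_rev, s_inv]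
        rw [sAff_succ, this, len_inv hr, len_inv hr]; omega)
      (by rw [← hl3, sAff_succ, e2, e1, len_inv hr, len_inv hr]; omega)
    rw [← hl3, sAff_succ, ← mul_assoc] at g4
    set z := (l'.map s).prod
    have hz : z ∈ parabolic K₂ := word_mem_parabolic fun j hj => hl1 j (g2.subset hj)
    have g5 : perm w * s a * (perm w)⁻¹ = z * x := by
      rw [mul_assoc, eq_mul_inv_of_mul_eq g4]; group
    have hzx : z * x ∈ parabolic K₂ := mul_mem hz h
    -- Comparing `len (z x w) = len (z x) + len w` with `len (w s_a) = len w + 1` shows that `w s_a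
    -- w⁻¹ = z x` has length one, so it is a simple reflection in `K₂`.
    have g6 := (leftMin_of_shortest hw).len_mul hr hzx
    rw [← g5, inv_mul_cancel_right, g5] at g6
    obtain ⟨j, hj, u, hu, g7, g8⟩ := exists_parabolic_left_descent hr hzx (by
      intro h0; rw [h0, len_one] at g6; omega)
    rw [eq_one_of_len_eq_zero hr hu (by omega), mul_one] at g7
    have hmem : a ∈ meet K₁ K₂ w := mem_meet_iff.2 ⟨ha, j, hj, by rw [g5, g7]⟩
    refine mul_mem (ih hy' ?_ (by omega)) (s_mem_parabolic hmem)
    have : perm w * y' * (perm w)⁻¹ = x * (z * x)⁻¹ := by rw [← g5, hx]; group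
    rw [this]
    exact mul_mem h (inv_mem hzx)

theorem conj_mem_parabolic {x : W r} {K₁ K₂ : Finset (Fin r)}
    (hx : x ∈ parabolic (meet K₁ K₂ w)) :
    perm w * x * (perm w)⁻¹ ∈ parabolic (conj w (meet K₁ K₂ w)) := by
  have : parabolic (meet K₁ K₂ w) ≤
      (parabolic (conj w (meet K₁ K₂ w))).comap (MulAut.conj (perm w)).toMonoidHom := by
    refine (Subgroup.closure_le _).2 ?_
    rintro _ ⟨i, hi, rfl⟩
    obtain ⟨-, j, hj, h⟩ := mem_meet_iff.1 hi
    change perm w * s i * (perm w)⁻¹ ∈ parabolic (conj w (meet K₁ K₂ w))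
    rw [h]
    have hj' : j ∈ conj w (meet K₁ K₂ w) := mem_conj_iff.2 ⟨i, hi, h⟩
    exact s_mem_parabolic hj'
  exact this hx

end Shortest

theorem mono_injective : Function.Injective (mono (r := r)) :=
  SemidirectProduct.inl_injective.comp Multiplicative.ofAdd.injective

theorem perm_conj_mono (σ : Equiv.Perm (Fin (r + 1))) (a : Fin (r + 1) → ℤ) :
    perm σ * mono a * (perm σ)⁻¹ = mono fun i => a (σ⁻¹ i) := by
  rw [← perm_inv, perm, mono, perm, ← SemidirectProduct.inl_aut]
  rfl

theorem perm_conj_var (σ : Equiv.Perm (Fin (r + 1))) (i : Fin (r + 1)) :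
    perm σ * var i * (perm σ)⁻¹ = var (σ i) := by
  rw [var, perm_conj_mono, var]
  congr 1
  funext j
  simp only [Pi.single_apply]
  congr 1
  rw [Equiv.Perm.inv_eq_iff_eq, eq_comm]

theorem var_injective : Function.Injective (var (r := r)) := by
  intro i j h
  have := congrFun (mono_injective h) i
  by_contra hij
  simp [hij] at this

theorem perm_right {J : Finset (Fin r)} {x : W r} (hx : x ∈ parabolic J) : perm x.right = x := by
  have h : parabolic J ≤ (SemidirectProduct.inr : Equiv.Perm (Fin (r + 1)) →* W r).range := by
    rw [parabolic, Subgroup.closure_le]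
    rintro _ ⟨i, -, rfl⟩
    exact ⟨_, rfl⟩
  obtain ⟨σ, rfl⟩ := h hx
  rfl

theorem exists_perm_of_mem {J : Finset (Fin r)} {x : W r} (hx : x ∈ parabolic J) :
    ∃ σ, x = perm σ := ⟨_, (perm_right hx).symm⟩

theorem right_perm_mul_mono (w : Equiv.Perm (Fin (r + 1))) (p : Fin (r + 1) → ℤ) :
    (perm w * mono p).right = w := by
  simp [perm, mono]

theorem eq_of_mono_mul_perm {σ ρ : Equiv.Perm (Fin (r + 1))} {p p' : Fin (r + 1) → ℤ}
    (h : mono p * perm σ = perm ρ * mono p') : σ = ρ := by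
  have := congrArg SemidirectProduct.right h
  simpa [perm, mono] using this

theorem eq_of_perm_mul_mono {σ ρ : Equiv.Perm (Fin (r + 1))} {p p' : Fin (r + 1) → ℤ}
    (h : perm σ * mono p = perm ρ * mono p') : σ = ρ := by
  have := congrArg SemidirectProduct.right h
  simpa [perm, mono] using this

/-- The projection of `W` to the symmetric group fixes `W_K` and `W_J`, so it maps double cosets
into double cosets. -/
theorem perm_right_mem_dcoset {K J : Finset (Fin r)} {z d : W r} (h : z ∈ dcoset K J d) :
    perm z.right ∈ dcoset K J (perm d.right) := by
  obtain ⟨x, hx, y, hy, rfl⟩ := h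
  refine ⟨x, hx, y, hy, ?_⟩
  rw [SemidirectProduct.mul_right, SemidirectProduct.mul_right, perm_mul, perm_mul, perm_right hx,
    perm_right hy]

/-! ### Dominant monomials as orbit representatives -/

section Dominant

variable {J : Finset (Fin r)}

/-- If `k` is not in `J`, every generator of `W_J` preserves the initial segment ending at
`k.castSucc`. -/
theorem mem_of_parabolic_lt {σ : Equiv.Perm (Fin (r + 1))} (h : perm σ ∈ parabolic J)
    {i : Fin (r + 1)} {k : Fin r} (h1 : i ≤ k.castSucc) (h2 : k.castSucc < σ i) : k ∈ J := by
  by_contra hk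
  have key : ∀ g ∈ parabolic J, ∀ x : Fin (r + 1), g.right x ≤ k.castSucc ↔ x ≤ k.castSucc := by
    intro g hg
    induction hg using Subgroup.closure_induction with
    | mem g hg =>
      obtain ⟨j, hj, rfl⟩ := hg
      intro x
      have hjk : j ≠ k := fun h => hk (h ▸ hj)
      have hjk' : (j : ℕ) ≠ k := fun h => hjk (Fin.ext h)
      change Equiv.swap j.castSucc j.succ x ≤ _ ↔ _
      rw [Equiv.swap_apply_def]
      split_ifs with h1 h2 <;>
        simp only [Fin.le_def, Fin.ext_iff, Fin.val_succ, Fin.val_castSucc] at * <;> omega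
    | one => intro x; rfl
    | mul g h _ _ hg hh => intro x; rw [SemidirectProduct.mul_right, Equiv.Perm.mul_apply, hg, hh]
    | inv g _ hg =>
      intro x
      rw [SemidirectProduct.inv_right, ← hg]; simp
  exact absurd ((key _ h i).2 h1) (not_le.2 h2)

/-- If `X_i` and `X_j` are conjugate under `W_J`, all simple reflections between `i` and `j` belong
to `J`, so the inequality is a chain of neighbouring ones. -/
theorem dominant_iff {a : Fin (r + 1) → ℤ} :
    Dominant J a ↔ ∀ i ∈ J, a i.succ ≤ a i.castSucc := by
  constructor
  · intro h i hi
    refine h _ _ (Fin.castSucc_lt_succ).le ⟨s i, s_mem_parabolic hi, ?_⟩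
    rw [s, perm_conj_var, Equiv.swap_apply_left]
  · rintro h i j hij ⟨g, hg, hgi⟩
    obtain ⟨σ, rfl⟩ := exists_perm_of_mem hg
    rw [perm_conj_var] at hgi
    have hσ := var_injective hgi
    have key : ∀ n : ℕ, ∀ m : Fin (r + 1), (m : ℕ) = i + n → m ≤ j → a m ≤ a i := by
      intro n
      induction n with
      | zero => intro m hm _; rw [show m = i from Fin.ext hm]
      | succ n ih =>
        intro m hm hmj
        have hm0 : (i : ℕ) + n < r := by omega
        have h1 := ih (Fin.castSucc ⟨i + n, hm0⟩) rfl (by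
          simp only [Fin.le_def, Fin.val_castSucc] at *; omega)
        have h2 := h ⟨i + n, hm0⟩ (mem_of_parabolic_lt hg (i := i) (by
          simp only [Fin.le_def, Fin.val_castSucc]; omega) (by
          rw [hσ]; simp only [Fin.le_def, Fin.lt_def, Fin.val_castSucc] at *; omega))
        have h3 : m = Fin.succ ⟨i + n, hm0⟩ := Fin.ext (by simp [hm]; omega)
        rw [h3]
        exact h2.trans h1
    exact key (j - i) j (by simp only [Fin.le_def] at hij; omega) le_rfl

/-- Rearrangement: among the `W_J`-conjugates, one minimising the sum of `i * a i` is dominant,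
since swapping a neighbouring ascent would lower the sum by the size of the ascent. -/
theorem exists_dominant (J : Finset (Fin r)) (a : Fin (r + 1) → ℤ) :
    ∃ g ∈ parabolic J, ∃ a', Dominant J a' ∧ g * mono a * g⁻¹ = mono a' := by
  obtain ⟨g, hg, h⟩ := Set.exists_min_image _
    (fun g : W r => ∑ i : Fin (r + 1), ((i : ℕ) : ℤ) * a (g.right⁻¹ i)) (parabolic_finite J)
    ⟨1, (parabolic J).one_mem⟩
  obtain ⟨σ, rfl⟩ := exists_perm_of_mem hg
  refine ⟨_, hg, _, dominant_iff.2 fun i hi => ?_, perm_conj_mono σ a⟩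
  by_contra hlt
  have h1 := h (s i * perm σ) (mul_mem (s_mem_parabolic hi) hg)
  have h2 : ∑ x : Fin (r + 1), ((x : ℕ) : ℤ) * a ((s i * perm σ).right⁻¹ x) =
      ∑ x : Fin (r + 1), ((Equiv.swap i.castSucc i.succ x : Fin (r + 1)) : ℤ) * a (σ⁻¹ x) := by
    rw [← Equiv.sum_comp (Equiv.swap i.castSucc i.succ)]
    refine Finset.sum_congr rfl fun x _ => ?_
    congr 2
    have : (s i * perm σ).right = Equiv.swap i.castSucc i.succ * σ := rfl
    rw [this, mul_inv_rev, Equiv.Perm.mul_apply, Equiv.swap_inv, Equiv.swap_apply_self]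
  have h3 : ∑ x : Fin (r + 1), ((x : ℕ) : ℤ) * a ((s i * perm σ).right⁻¹ x) -
      ∑ x : Fin (r + 1), ((x : ℕ) : ℤ) * a (σ⁻¹ x) = a (σ⁻¹ i.castSucc) - a (σ⁻¹ i.succ) := by
    rw [h2, ← Finset.sum_sub_distrib, Fintype.sum_eq_add i.castSucc i.succ]
    · rw [Equiv.swap_apply_left, Equiv.swap_apply_right, Fin.val_succ, Fin.val_castSucc]
      push_cast; ring
    · exact (Fin.castSucc_lt_succ).ne
    · rintro x ⟨hx1, hx2⟩
      rw [Equiv.swap_apply_of_ne_of_ne hx1 hx2, sub_self]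
  have h4 : (perm σ).right = σ := rfl
  simp only [h4] at h1
  linarith

/-- Let `s_i` be a right descent of the conjugating permutation `σ`. Then `σ` inverts the neighbours
`i`, `i + 1`, and dominance of both vectors forces `a` to agree there. So `s_i` fixes the monomial,
and `σ` can be shortened. -/
theorem dominant_unique (hr : 1 ≤ r) {a a' : Fin (r + 1) → ℤ} (ha : Dominant J a)
    (ha' : Dominant J a') {g : W r} (hg : g ∈ parabolic J) (h : g * mono a * g⁻¹ = mono a') :
    a = a' := by
  induction hn : len g generalizing g with
  | zero =>
    rw [eq_one_of_len_eq_zero hr hg hn, one_mul, inv_one, mul_one] at h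
    exact mono_injective h
  | succ n ih =>
    obtain ⟨i, hi, y, hy, e, h1⟩ := exists_parabolic_right_descent hr hg (by
      rintro rfl; rw [len_one] at hn; omega)
    have hs := s_mem_parabolic hi
    obtain ⟨σ, rfl⟩ := exists_perm_of_mem hg
    have h2 : y = perm σ * s i := by rw [e, mul_assoc, s_mul_self, mul_one]
    have h3 : ¬ len (perm σ) < len (perm σ * sAff i.succ) := by rw [sAff_succ, ← h2]; omega
    rw [len_lt_mul_sAff_iff hr] at h3
    have e3 : (((i.succ : Fin (r + 1)) : ℕ) : ℤ) - 1 = ((i.castSucc : Fin (r + 1)) : ℕ) := by simp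
    rw [e3, zfun_perm_coe, zfun_perm_coe] at h3
    have h4 : ∀ x, a' (σ x) = a x := by
      intro x
      rw [perm_conj_mono] at h
      rw [← mono_injective h]; simp
    have h5 : a i.succ ≤ a i.castSucc := dominant_iff.1 ha i hi
    have h6 : a' (σ i.castSucc) ≤ a' (σ i.succ) := by
      refine ha' _ _ (by simp only [Fin.le_def]; omega)
        ⟨perm σ * s i * (perm σ)⁻¹, mul_mem (mul_mem hg hs) (inv_mem hg), ?_⟩
      rw [s, ← perm_mul, ← perm_inv, ← perm_mul, perm_conj_var]
      simp
    rw [h4, h4] at h6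
    have h7 : a i.succ = a i.castSucc := le_antisymm h5 h6
    have h8 : s i * mono a * (s i)⁻¹ = mono a := by
      rw [s, perm_conj_mono]
      congr 1
      funext x
      rw [Equiv.swap_inv, Equiv.swap_apply_def]
      split_ifs with g1 g2
      · rw [g1, h7]
      · rw [g2, h7]
      · rfl
    refine ih hy ?_ (by omega)
    calc y * mono a * y⁻¹ = perm σ * (s i * mono a * (s i)⁻¹) * (perm σ)⁻¹ := by rw [h2]; group
      _ = mono a' := by rw [h8, h]

end Dominant

/-! ### Labels parametrise the double cosets of `W` -/

section Labels

variable {K₁ K₂ : Finset (Fin r)}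

/-- The double coset representative `w p` of a label `(w, p)`. -/
def Label.elt (x : Label K₂ K₁) : W r := perm x.1.1 * mono x.1.2

theorem Label.elt_right (x : Label K₂ K₁) : x.elt.right = x.1.1 := right_perm_mul_mono _ _

theorem exists_shortest (σ : Equiv.Perm (Fin (r + 1))) :
    ∃ w ∈ shortest K₂ K₁, perm σ ∈ dcoset K₂ K₁ (perm w) := by
  obtain ⟨u, hu, h⟩ := Set.exists_min_image _ len (dcoset_finite K₂ K₁ (perm σ))
    ⟨_, mem_dcoset_self _ _ _⟩
  have e : u = perm u.right := by
    obtain ⟨x, hx, y, hy, rfl⟩ := hu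
    obtain ⟨_, rfl⟩ := exists_perm_of_mem hx
    obtain ⟨_, rfl⟩ := exists_perm_of_mem hy
    rfl
  rw [e] at hu
  refine ⟨u.right, fun v hv => ?_, mem_dcoset_symm hu⟩
  rw [dcoset_eq hu] at hv
  rw [← e]
  exact h v hv

/-- Write `d = X^a x w y` and move the monomial to the right of `x w`. The element `g` of `W_J` that
makes it dominant splits off on both sides: `g` joins `W_{K₁}`, and `w g⁻¹ w⁻¹` joins `W_{K₂}`. -/
theorem exists_label (d : W r) : ∃ x : Label K₂ K₁, d ∈ dcoset K₂ K₁ x.elt := by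
  obtain ⟨w, hw, x, hx, y, hy, e⟩ := exists_shortest (K₂ := K₂) (K₁ := K₁) d.right
  obtain ⟨a, ha⟩ : ∃ a, d = mono a * perm d.right :=
    ⟨d.left.toAdd, by
      rw [mono, perm, ofAdd_toAdd]
      exact (SemidirectProduct.inl_left_mul_inr_right d).symm⟩
  obtain ⟨σ, hσ⟩ : ∃ σ, x * perm w = perm σ := by
    obtain ⟨ρ, rfl⟩ := exists_perm_of_mem hx
    exact ⟨_, (perm_mul _ _).symm⟩
  obtain ⟨g, hg, p, hp, h⟩ := exists_dominant (meet K₁ K₂ w) fun i => a (σ i)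
  have h1 : mono a * perm σ = perm σ * mono fun i => a (σ i) := by
    have := perm_conj_mono σ fun i => a (σ i)
    have e' : (fun i => a (σ (σ⁻¹ i))) = a := by funext i; simp
    rw [e'] at this
    rw [← this]; group
  have h2 : (mono fun i => a (σ i)) = g⁻¹ * mono p * g := by rw [← h]; group
  refine ⟨⟨(w, p), hw, hp⟩, x * (perm w * g⁻¹ * (perm w)⁻¹), mul_mem hx ?_, g * y,
    mul_mem (parabolic_mono (meet_subset _ _ _) hg) hy, ?_⟩
  · exact parabolic_mono (conj_meet_subset _ _ _) (conj_mem_parabolic (inv_mem hg))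
  · change d = _ * (perm w * mono p) * _
    rw [ha, e, hσ, ← mul_assoc (mono a), h1, h2, ← hσ]
    group

/-- Projection to the symmetric group gives `w' = w` and then `ρ w σ = w`. Thus `σ` lies in `W_{K₁}
∩ w⁻¹ W_{K₂} w = W_J` and conjugates one dominant monomial into the other. -/
theorem Label.eq_of_mem (hr : 1 ≤ r) {x x' : Label K₂ K₁} (h : x'.elt ∈ dcoset K₂ K₁ x.elt) :
    x' = x := by
  have h0 := perm_right_mem_dcoset h
  rw [elt_right, elt_right] at h0
  obtain ⟨⟨w, p⟩, hw, hp⟩ := x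
  obtain ⟨⟨w', p'⟩, hw', hp'⟩ := x'
  have h1 : w' = w := shortest_unique hr hw hw' h0
  subst h1
  obtain ⟨u, hu, y, hy, e⟩ := h
  change perm w' * mono p' = u * (perm w' * mono p) * y at e
  obtain ⟨ρ, rfl⟩ := exists_perm_of_mem hu
  obtain ⟨σ, rfl⟩ := exists_perm_of_mem hy
  have e2 : perm (ρ * w' * σ) * (((perm σ)⁻¹ * mono p * (perm σ)⁻¹⁻¹)) = perm w' * mono p' := by
    rw [e, perm_mul, perm_mul]; group
  rw [← perm_inv σ, perm_conj_mono] at e2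
  have e3 := eq_of_perm_mul_mono e2
  have h2 : perm σ ∈ parabolic (meet K₁ K₂ w') := by
    refine mem_parabolic_meet hr hw hy ?_
    have : perm w' * perm σ * (perm w')⁻¹ = (perm ρ)⁻¹ := by
      nth_rw 2 [← e3]
      rw [perm_mul, perm_mul]; group
    rw [this]
    exact inv_mem hu
  have h3 : p = p' := by
    refine dominant_unique hr hp hp' (inv_mem h2) ?_
    rw [e3] at e2
    rw [← perm_inv σ, perm_conj_mono]
    exact mul_left_cancel e2
  subst h3
  rfl

end Labels

end Combinatorics

/-! ### Coefficients with respect to the basis `T_w` -/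

section Coefficients

variable {k : Type*} [Field k] {q : k} {r : ℕ} (hr : 1 ≤ r)

/-- The coefficient of `T_w` in an element of the Hecke algebra. -/
noncomputable def coef (w : W r) : Hecke q r →ₗ[k] k :=
  Finsupp.lapply w ∘ₗ (basisT q hr).repr.toLinearMap

theorem coef_T [DecidableEq (W r)] (w y : W r) :
    coef hr w (T q y) = if y = w then 1 else 0 := by
  simp [coef, repr_T, Finsupp.single_apply]

theorem ext_coef {h h' : Hecke q r} (e : ∀ w, coef hr w h = coef hr w h') : h = h' :=
  (basisT q hr).repr.injective (Finsupp.ext e)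

theorem linearMap_ext_T (hr : 1 ≤ r) {M : Type*} [AddCommGroup M] [Module k M] {f g : Hecke q r →ₗ[k] M}
    (hfg : ∀ w, f (T q w) = g (T q w)) : f = g :=
  (basisT q hr).ext fun w => by rw [basisT_apply, hfg]

open Classical in
-- The transpose of the multiplication rule for `T_{s_i}`: the factor `q` now belongs to the case in
-- which `s_i` lengthens `w`.
theorem coef_sAff_mul (i : Fin (r + 1)) (w : W r) (h : Hecke q r) :
    coef hr w (T q (sAff i) * h) = if len w < len (sAff i * w) then q * coef hr (sAff i * w) h
      else coef hr (sAff i * w) h + (q - 1) * coef hr w h := by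
  have key : coef hr w ∘ₗ LinearMap.mulLeft k (T q (sAff i)) =
      if len w < len (sAff i * w) then q • coef hr (sAff i * w)
      else coef hr (sAff i * w) + (q - 1) • coef hr w := by
    refine linearMap_ext_T hr fun y => ?_
    rw [LinearMap.comp_apply, LinearMap.mulLeft_apply]
    have e : sAff i * y = w ↔ y = sAff i * w := by
      constructor
      · rintro rfl; rw [sAff_mul_cancel_left hr]
      · rintro rfl; rw [sAff_mul_cancel_left hr]
    have h1 := len_sAff_mul hr w i
    by_cases hy : len y < len (sAff i * y)
    · rw [T_sAff_mul_of_lt q hr hy, coef_T]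
      by_cases h2 : y = sAff i * w
      · subst h2
        rw [sAff_mul_cancel_left hr] at hy
        have h3 : sAff i * w ≠ w := fun h => by rw [h] at hy; omega
        rw [sAff_mul_cancel_left hr, if_pos rfl, if_neg (by omega)]
        simp [coef_T, h3]
      · rw [if_neg (mt e.1 h2)]
        split_ifs with h4
        · simp [coef_T, h2]
        · have h5 : y ≠ w := by rintro rfl; exact h4 hy
          simp [coef_T, h2, h5]
    · rw [T_sAff_mul_of_not_lt q hr hy, map_add, map_smul, map_smul, coef_T, coef_T]
      by_cases h2 : y = sAff i * w
      · subst h2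
        rw [sAff_mul_cancel_left hr] at hy
        have h3 : sAff i * w ≠ w := fun h => by rw [h] at h1; omega
        rw [if_pos (by omega : len w < len (sAff i * w))]
        simp [coef_T, h3, sAff_mul_cancel_left hr]
      · rw [if_neg (mt e.1 h2)]
        by_cases h4 : y = w
        · subst h4
          simp [coef_T, h2, hy]
        · split_ifs <;> simp [coef_T, h2, h4]
  have := LinearMap.congr_fun key h
  rw [LinearMap.comp_apply, LinearMap.mulLeft_apply] at this
  rw [this]
  split_ifs <;> simp

/-- The anti-automorphism `T_w ↦ T_{w⁻¹}`. -/
noncomputable def revHom (q : k) (hr : 1 ≤ r) : Hecke q r →ₐ[k] (Hecke q r)ᵐᵒᵖ :=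
  RingQuot.liftAlgHom k ⟨FreeAlgebra.lift k fun w => MulOpposite.op (T q w⁻¹), by
    intro a b h
    induction h with
    | one => rw [FreeAlgebra.lift_ι_apply, map_one, inv_one, T_one, MulOpposite.op_one]
    | mul x y h =>
      rw [map_mul, FreeAlgebra.lift_ι_apply, FreeAlgebra.lift_ι_apply, FreeAlgebra.lift_ι_apply,
        ← MulOpposite.op_mul, T_mul, mul_inv_rev]
      rw [← mul_inv_rev, len_inv hr, len_inv hr, len_inv hr, h, add_comm]
    | quad i =>
      simp only [map_mul, map_sub, map_add, map_zero, map_one, FreeAlgebra.lift_ι_apply,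
        AlgHom.commutes, sAff_inv hr]
      rw [MulOpposite.algebraMap_apply, ← MulOpposite.op_sub, ← MulOpposite.op_one,
        ← MulOpposite.op_add, ← MulOpposite.op_mul, ← MulOpposite.op_zero]
      congr 1
      rw [Algebra.algebraMap_eq_smul_one, add_mul, mul_sub, T_sAff_mul_self, mul_smul_comm, mul_one,
        one_mul]
      module⟩

theorem revHom_T (w : W r) : revHom q hr (T q w) = MulOpposite.op (T q w⁻¹) := by
  rw [T, revHom]
  erw [RingQuot.liftAlgHom_mkAlgHom_apply]
  rw [FreeAlgebra.lift_ι_apply]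

/-- The linear map `T_w ↦ T_{w⁻¹}`. -/
noncomputable def rev : Hecke q r →ₗ[k] Hecke q r :=
  (MulOpposite.opLinearEquiv k).symm.toLinearMap ∘ₗ (revHom q hr).toLinearMap

theorem rev_T (w : W r) : rev hr (T q w) = T q w⁻¹ := by
  simp [rev, revHom_T]

theorem rev_mul (a b : Hecke q r) : rev hr (a * b) = rev hr b * rev hr a := by
  simp [rev]

theorem rev_rev (a : Hecke q r) : rev hr (rev hr a) = a := by
  have : rev hr ∘ₗ rev hr = (LinearMap.id : Hecke q r →ₗ[k] _) :=
    linearMap_ext_T hr fun w => by simp [rev_T]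
  exact LinearMap.congr_fun this a

theorem coef_rev (w : W r) (a : Hecke q r) : coef hr w (rev hr a) = coef hr w⁻¹ a := by
  classical
  have : coef hr w ∘ₗ rev hr = (coef hr w⁻¹ : Hecke q r →ₗ[k] _) :=
    linearMap_ext_T hr fun y => by simp [rev_T, coef_T, inv_eq_iff_eq_inv]
  exact LinearMap.congr_fun this a

/-! ### Eigenvectors of the `T_s` as functions constant on cosets -/

/-- Elements with `T_s h = q h` for all `s` in `K`. -/
def LeftConst (K : Finset (Fin r)) (h : Hecke q r) : Prop := ∀ i ∈ K, T q (s i) * h = q • h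

/-- Elements with `h T_s = q h` for all `s` in `K`. -/
def RightConst (K : Finset (Fin r)) (h : Hecke q r) : Prop := ∀ i ∈ K, h * T q (s i) = q • h

theorem rightConst_iff {K : Finset (Fin r)} {h : Hecke q r} :
    RightConst K h ↔ LeftConst K (rev hr h) := by
  have e : ∀ i, rev hr (T q (s i)) = T q (s i) := fun i => by rw [rev_T, s_inv]
  constructor
  · intro H i hi
    rw [← e i, ← rev_mul, H i hi, map_smul]
  · intro H i hi
    apply (Function.LeftInverse.injective (rev_rev hr) : Function.Injective (rev (q := q) hr))
    rw [rev_mul, e i, H i hi, map_smul]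

theorem LeftConst.mul {K : Finset (Fin r)} {h : Hecke q r} (H : LeftConst K h) (a : Hecke q r) :
    LeftConst K (h * a) := fun i hi => by rw [← mul_assoc, H i hi, smul_mul_assoc]

theorem RightConst.mul {K : Finset (Fin r)} {h : Hecke q r} (H : RightConst K h) (a : Hecke q r) :
    RightConst K (a * h) := fun i hi => by rw [mul_assoc, H i hi, mul_smul_comm]

theorem LeftConst.sub_smul {K : Finset (Fin r)} {h h' : Hecke q r} (H : LeftConst K h)
    (H' : LeftConst K h') (c : k) : LeftConst K (h - c • h') := fun i hi => by
  rw [mul_sub, mul_smul_comm, H i hi, H' i hi, smul_sub, smul_comm]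

theorem RightConst.sub_smul {K : Finset (Fin r)} {h h' : Hecke q r} (H : RightConst K h)
    (H' : RightConst K h') (c : k) : RightConst K (h - c • h') := fun i hi => by
  rw [sub_mul, smul_mul_assoc, H i hi, H' i hi, smul_sub, smul_comm]

/-- Comparing coefficients in `T_s h = q h` gives `q c(sw) = q c(w)` when `s` lengthens `w`, and
`c(sw) + (q - 1) c(w) = q c(w)` otherwise. The first equation is where `q ≠ 0` is indispensable. -/
theorem leftConst_iff (hq : q ≠ 0) {K : Finset (Fin r)} {h : Hecke q r} :
    LeftConst K h ↔ ∀ x ∈ parabolic K, ∀ w, coef hr (x * w) h = coef hr w h := by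
  constructor
  · intro H x hx
    have hs : ∀ i ∈ K, ∀ w, coef hr (s i * w) h = coef hr w h := by
      intro i hi w
      have h1 := congrArg (coef hr w) (H i hi)
      rw [← sAff_succ, coef_sAff_mul, map_smul, smul_eq_mul, sAff_succ] at h1
      split_ifs at h1
      · exact mul_left_cancel₀ hq h1
      · linear_combination h1
    induction hx using Subgroup.closure_induction with
    | mem x hx => obtain ⟨i, hi, rfl⟩ := hx; exact hs i hi
    | one => intro w; rw [one_mul]
    | mul x y _ _ hx hy => intro w; rw [mul_assoc, hx, hy]
    | inv x _ hx => intro w; rw [← hx, mul_inv_cancel_left]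
  · intro H i hi
    refine ext_coef hr fun w => ?_
    rw [← sAff_succ, coef_sAff_mul, map_smul, smul_eq_mul, sAff_succ, H _ (s_mem_parabolic hi)]
    split_ifs
    · rfl
    · ring

theorem rightConst_coef_iff (hq : q ≠ 0) {K : Finset (Fin r)} {h : Hecke q r} :
    RightConst K h ↔ ∀ x ∈ parabolic K, ∀ w, coef hr (w * x) h = coef hr w h := by
  rw [rightConst_iff hr, leftConst_iff hr hq]
  constructor
  · intro H x hx w
    have := H x⁻¹ (inv_mem hx) w⁻¹
    rwa [coef_rev, coef_rev, mul_inv_rev, inv_inv, inv_inv] at this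
  · intro H x hx w
    rw [coef_rev, coef_rev, mul_inv_rev, H _ (inv_mem hx)]

open Classical in
theorem coef_dsum (K J : Finset (Fin r)) (d w : W r) :
    coef hr w (dsum q K J d) = if w ∈ dcoset K J d then 1 else 0 := by
  simp [dsum, coef_T]

open Classical in
theorem coef_v (K : Finset (Fin r)) (w : W r) :
    coef hr w (v q K) = if w ∈ parabolic K then 1 else 0 := by
  simp [v, coef_T]

theorem leftConst_dsum (hr : 1 ≤ r) (hq : q ≠ 0) (K J : Finset (Fin r)) (d : W r) :
    LeftConst K (dsum q K J d) := by
  classical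
  exact (leftConst_iff hr hq).2 fun x hx w => by
    rw [coef_dsum, coef_dsum, if_congr (mul_left_mem_dcoset_iff hx) rfl rfl]

theorem rightConst_dsum (hr : 1 ≤ r) (hq : q ≠ 0) (K J : Finset (Fin r)) (d : W r) :
    RightConst J (dsum q K J d) := by
  classical
  exact (rightConst_coef_iff hr hq).2 fun x hx w => by
    rw [coef_dsum, coef_dsum, if_congr (mul_right_mem_dcoset_iff hx) rfl rfl]

theorem leftConst_v (hr : 1 ≤ r) (hq : q ≠ 0) {J K : Finset (Fin r)} (h : J ⊆ K) : LeftConst J (v q K) := by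
  classical
  exact (leftConst_iff hr hq).2 fun x hx w => by
    rw [coef_v, coef_v, if_congr ((parabolic K).mul_mem_cancel_left (parabolic_mono h hx)) rfl rfl]

theorem rightConst_v (hr : 1 ≤ r) (hq : q ≠ 0) {J K : Finset (Fin r)} (h : J ⊆ K) : RightConst J (v q K) := by
  classical
  exact (rightConst_coef_iff hr hq).2 fun x hx w => by
    rw [coef_v, coef_v, if_congr ((parabolic K).mul_mem_cancel_right (parabolic_mono h hx)) rfl rfl]

theorem coef_eq_of_mem_dcoset (hq : q ≠ 0) {K J : Finset (Fin r)} {h : Hecke q r}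
    (h1 : LeftConst K h) (h2 : RightConst J h) {d u : W r} (hu : u ∈ dcoset K J d) :
    coef hr u h = coef hr d h := by
  obtain ⟨x, hx, y, hy, rfl⟩ := hu
  rw [(rightConst_coef_iff hr hq).1 h2 y hy, (leftConst_iff hr hq).1 h1 x hx]

/-- An element which is constant on double cosets is a combination of double coset sums. -/
theorem mem_span_dsum (hq : q ≠ 0) {K J : Finset (Fin r)} {h : Hecke q r}
    (h1 : LeftConst K h) (h2 : RightConst J h) :
    h ∈ Submodule.span k (dsum q K J '' {d | coef hr d h ≠ 0}) := by
  classical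
  induction hn : ((basisT q hr).repr h).support.card using Nat.strong_induction_on generalizing h with
  | _ n ih =>
  by_cases h0 : ∃ d, coef hr d h ≠ 0
  · obtain ⟨d, hd⟩ := h0
    -- The coefficients of `h` are constant on the double coset of `d`, so the subtraction erases it
    -- from the support and changes nothing else.
    set h' := h - coef hr d h • dsum q K J d with hh'
    have e : ∀ w, coef hr w h' = if w ∈ dcoset K J d then 0 else coef hr w h := by
      intro w
      rw [hh', map_sub, map_smul, coef_dsum, smul_eq_mul]
      split_ifs with hw
      · rw [coef_eq_of_mem_dcoset hr hq h1 h2 hw]; ring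
      · ring
    have hsub : {w | coef hr w h' ≠ 0} ⊆ {w | coef hr w h ≠ 0} := by
      intro w hw
      simp only [Set.mem_ofPred_eq, e] at hw
      split_ifs at hw
      · exact absurd rfl hw
      · exact hw
    have hlt : ((basisT q hr).repr h').support.card < n := by
      rw [← hn]
      apply Finset.card_lt_card
      rw [Finset.ssubset_iff_of_subset]
      · refine ⟨d, Finsupp.mem_support_iff.2 hd, fun hd' => ?_⟩
        have := e d
        rw [if_pos (mem_dcoset_self _ _ _)] at this
        exact Finsupp.mem_support_iff.1 hd' this
      · intro w hw
        rw [Finsupp.mem_support_iff] at hw ⊢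
        exact hsub hw
    have h3 := ih _ hlt (h1.sub_smul (leftConst_dsum hr hq K J d) _)
      (h2.sub_smul (rightConst_dsum hr hq K J d) _) rfl
    have h4 := Submodule.span_mono (Set.image_mono hsub) h3
    have e5 : h = h' + coef hr d h • dsum q K J d := by rw [hh', sub_add_cancel]
    rw [e5]
    refine Submodule.add_mem _ ?_ (Submodule.smul_mem _ _ (Submodule.subset_span ⟨d, ?_, rfl⟩))
    · rw [← e5]; exact h4
    · rw [← e5]; exact hd
  · push Not at h0
    rw [ext_coef hr (h' := 0) (h := h) fun w => by rw [h0, map_zero]]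
    exact Submodule.zero_mem _

theorem mem_dcoset_empty_right {K : Finset (Fin r)} {d u : W r} :
    u ∈ dcoset K ∅ d ↔ ∃ x ∈ parabolic K, u = x * d := by
  simp [dcoset, parabolic_empty]

theorem mem_dcoset_empty_left {K : Finset (Fin r)} {d u : W r} :
    u ∈ dcoset ∅ K d ↔ ∃ x ∈ parabolic K, u = d * x := by
  simp [dcoset, parabolic_empty]

theorem rev_v (K : Finset (Fin r)) : rev hr (v q K) = v q K := by
  classical
  refine ext_coef hr fun w => ?_
  rw [coef_rev, coef_v, coef_v, if_congr inv_mem_iff rfl rfl]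

theorem rev_dsum (K J : Finset (Fin r)) (d : W r) :
    rev hr (dsum q K J d) = dsum q J K d⁻¹ := by
  classical
  refine ext_coef hr fun w => ?_
  rw [coef_rev, coef_dsum, coef_dsum]
  refine if_congr ⟨?_, ?_⟩ rfl rfl
  · rintro ⟨x, hx, y, hy, e⟩
    exact ⟨y⁻¹, inv_mem hy, x⁻¹, inv_mem hx, by rw [← inv_inv w, e]; group⟩
  · rintro ⟨x, hx, y, hy, e⟩
    exact ⟨y⁻¹, inv_mem hy, x⁻¹, inv_mem hx, by rw [e]; group⟩

theorem v_mul_T_of_leftMin (hr : 1 ≤ r) {K : Finset (Fin r)} {g : W r} (hg : LeftMin K g) :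
    v q K * T q g = dsum q K ∅ g := by
  classical
  rw [v, Finset.sum_mul, dsum]
  refine Finset.sum_bij' (fun x _ => x * g) (fun x _ => x * g⁻¹) ?_ ?_ ?_ ?_ ?_
  · intro x hx
    rw [Set.Finite.mem_toFinset] at hx ⊢
    exact mem_dcoset_empty_right.2 ⟨x, hx, rfl⟩
  · intro x hx
    rw [Set.Finite.mem_toFinset] at hx ⊢
    obtain ⟨y, hy, rfl⟩ := mem_dcoset_empty_right.1 hx
    rw [mul_inv_cancel_right]; exact hy
  · intro x _; exact mul_inv_cancel_right x g
  · intro x _; exact inv_mul_cancel_right x g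
  · intro x hx
    rw [Set.Finite.mem_toFinset] at hx
    exact T_mul q (hg.len_mul hr hx)

theorem v_mul_T_of_mem (hr : 1 ≤ r) (hq : q ≠ 0) {K : Finset (Fin r)} {x : W r} (hx : x ∈ parabolic K) :
    v q K * T q x = q ^ len x • v q K := by
  induction hn : len x generalizing x with
  | zero => rw [eq_one_of_len_eq_zero hr hx hn, T_one, mul_one, pow_zero, one_smul]
  | succ n ih =>
    obtain ⟨i, hi, y, hy, rfl, h1⟩ := exists_parabolic_left_descent hr hx (by
      rintro rfl; rw [len_one] at hn; omega)
    have h2 : T q (s i * y) = T q (s i) * T q y := by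
      rw [T_mul]
      rw [h1, ← sAff_succ, len_sAff hr, add_comm]
    rw [h2, ← mul_assoc, rightConst_v hr hq subset_rfl i hi, smul_mul_assoc, ih hy (by omega),
      smul_smul, pow_succ']

/-- Factor `g` into an element of `W_K`, which `v_K` turns into a power of `q`, and the minimal
element of `W_K g`. -/
theorem v_mul_T (hr : 1 ≤ r) (hq : q ≠ 0) (K : Finset (Fin r)) (g : W r) :
    ∃ a : ℕ, v q K * T q g = q ^ a • dsum q K ∅ g := by
  obtain ⟨x, hx, hg⟩ := exists_leftMin K g
  have h1 := hg.len_mul hr (inv_mem hx)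
  have h2 : T q g = T q x⁻¹ * T q (x * g) := by rw [T_mul q h1, inv_mul_cancel_left]
  refine ⟨len x⁻¹, ?_⟩
  rw [h2, ← mul_assoc, v_mul_T_of_mem hr hq (inv_mem hx), smul_mul_assoc, v_mul_T_of_leftMin hr hg]
  congr 1
  have h3 : dcoset K ∅ (x * g) = dcoset K ∅ g :=
    dcoset_eq (mem_dcoset_empty_right.2 ⟨x, hx, rfl⟩)
  rw [dsum, dsum]
  congr 1
  ext; simp [h3]

theorem T_mul_v (hr : 1 ≤ r) (hq : q ≠ 0) (K : Finset (Fin r)) (g : W r) :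
    ∃ a : ℕ, T q g * v q K = q ^ a • dsum q ∅ K g := by
  obtain ⟨a, ha⟩ := v_mul_T hr hq K g⁻¹
  refine ⟨a, ?_⟩
  have := congrArg (rev hr) ha
  rwa [rev_mul, rev_v, rev_T, inv_inv, map_smul, rev_dsum, inv_inv] at this

open Classical in
/-- The part of an element supported on minimal representatives of left cosets of `W_K`. -/
noncomputable def leftPart (K : Finset (Fin r)) (h : Hecke q r) : Hecke q r :=
  ∑ g ∈ ((basisT q hr).repr h).support.filter (LeftMin K), coef hr g h • T q g

/-- An element which is constant on left cosets of `W_K` lies in `v_K H`. -/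
theorem LeftConst.eq_mul (hq : q ≠ 0) {K : Finset (Fin r)} {h : Hecke q r} (H : LeftConst K h) :
    h = v q K * leftPart hr K h := by
  classical
  refine ext_coef hr fun z => ?_
  rw [leftPart, Finset.mul_sum, map_sum]
  obtain ⟨x, hx, hz⟩ := exists_leftMin K z
  have h1 : coef hr (x * z) h = coef hr z h := (leftConst_iff hr hq).1 H x hx z
  rw [Finset.sum_eq_single (x * z)]
  · rw [mul_smul_comm, v_mul_T_of_leftMin hr hz, map_smul, coef_dsum, if_pos, smul_eq_mul, mul_one,
      h1]
    exact mem_dcoset_empty_right.2 ⟨x⁻¹, inv_mem hx, by rw [inv_mul_cancel_left]⟩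
  · intro g hg hne
    have hg' := (Finset.mem_filter.1 hg).2
    rw [mul_smul_comm, v_mul_T_of_leftMin hr hg', map_smul, coef_dsum, if_neg, smul_zero]
    intro hzg
    obtain ⟨y, hy, e⟩ := mem_dcoset_empty_right.1 hzg
    exact hne (hz.eq_of_mem hr hg' (mul_mem (inv_mem hy) (inv_mem hx)) (by rw [e]; group))
  · intro hnot
    have : coef hr (x * z) h = 0 := by
      by_contra h0
      exact hnot (Finset.mem_filter.2 ⟨Finsupp.mem_support_iff.2 h0, hz⟩)
    rw [this, zero_smul, mul_zero, map_zero]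

open Classical in
/-- The part of an element supported on minimal representatives of right cosets of `W_K`. -/
noncomputable def rightPart (K : Finset (Fin r)) (h : Hecke q r) : Hecke q r :=
  ∑ g ∈ ((basisT q hr).repr h).support.filter (RightMin K), coef hr g h • T q g

/-- An element which is constant on right cosets of `W_K` lies in `H v_K`. -/
theorem RightConst.eq_mul (hq : q ≠ 0) {K : Finset (Fin r)} {h : Hecke q r} (H : RightConst K h) :
    h = rightPart hr K h * v q K := by
  classical
  have h1 := congrArg (rev hr) (((rightConst_iff hr).1 H).eq_mul hr hq)
  rw [rev_rev, rev_mul, rev_v] at h1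
  nth_rw 1 [h1]
  congr 1
  rw [leftPart, map_sum, rightPart]
  refine Finset.sum_bij' (fun x _ => x⁻¹) (fun x _ => x⁻¹) ?_ ?_ ?_ ?_ ?_
  · intro x hx
    rw [Finset.mem_filter, Finsupp.mem_support_iff] at hx ⊢
    refine ⟨?_, (rightMin_iff hr).2 (by rw [inv_inv]; exact hx.2)⟩
    have := hx.1
    change coef hr x (rev hr h) ≠ 0 at this
    rwa [coef_rev] at this
  · intro x hx
    rw [Finset.mem_filter, Finsupp.mem_support_iff] at hx ⊢
    refine ⟨?_, (rightMin_iff hr).1 hx.2⟩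
    change coef hr x⁻¹ (rev hr h) ≠ 0
    rw [coef_rev, inv_inv]
    exact hx.1
  · intro x _; exact inv_inv x
  · intro x _; exact inv_inv x
  · intro x _
    rw [map_smul, rev_T, coef_rev]

/-- Products of basis elements, the first in a finite parabolic subgroup, up to lower terms. -/
theorem T_mul_T (hr : 1 ≤ r) (K : Finset (Fin r)) {x : W r} (hx : x ∈ parabolic K) (g : W r) :
    ∃ a : ℕ, T q x * T q g - q ^ a • T q (x * g) ∈
      Submodule.span k {z | ∃ u ∈ parabolic K, len u < len x ∧ T q (u * g) = z} := by
  induction hn : len x generalizing x with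
  | zero =>
    refine ⟨0, ?_⟩
    rw [eq_one_of_len_eq_zero hr hx hn, T_one, one_mul, one_mul, pow_zero, one_smul, sub_self]
    exact Submodule.zero_mem _
  | succ n ih =>
    obtain ⟨i, hi, y, hy, rfl, h1⟩ := exists_parabolic_left_descent hr hx (by
      rintro rfl; rw [len_one] at hn; omega)
    have hyn : len y = n := by omega
    obtain ⟨a, ha⟩ := ih hy hyn
    set S := Submodule.span k {z | ∃ u ∈ parabolic K, len u < n + 1 ∧ T q (u * g) = z}
    have hs := s_mem_parabolic hi
    have h2 : T q (s i * y) = T q (s i) * T q y := by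
      rw [T_mul]
      rw [h1, ← sAff_succ, len_sAff hr, add_comm]
    have h3 : ∀ z ∈ Submodule.span k {z | ∃ u ∈ parabolic K, len u < n ∧ T q (u * g) = z},
        T q (s i) * z ∈ S := by
      intro z hz
      induction hz using Submodule.span_induction with
      | mem z hz =>
        obtain ⟨u, hu, hlt, rfl⟩ := hz
        have h5 := len_sAff_mul hr u i.succ
        rw [sAff_succ] at h5
        have m1 : T q (s i * (u * g)) ∈ S :=
          Submodule.subset_span ⟨s i * u, mul_mem hs hu, by omega, by rw [mul_assoc]⟩
        have m2 : T q (u * g) ∈ S := Submodule.subset_span ⟨u, hu, by omega, rfl⟩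
        rw [← sAff_succ] at m1 ⊢
        by_cases h4 : len (u * g) < len (sAff i.succ * (u * g))
        · rw [T_sAff_mul_of_lt q hr h4]; exact m1
        · rw [T_sAff_mul_of_not_lt q hr h4]
          exact S.add_mem (S.smul_mem _ m1) (S.smul_mem _ m2)
      | zero => rw [mul_zero]; exact S.zero_mem
      | add x y _ _ hx hy => rw [mul_add]; exact S.add_mem hx hy
      | smul c x _ hx => rw [mul_smul_comm]; exact S.smul_mem _ hx
    have h4 := h3 _ ha
    rw [mul_sub, ← mul_assoc, ← h2, mul_smul_comm] at h4
    have m : T q (y * g) ∈ S := Submodule.subset_span ⟨y, hy, by omega, rfl⟩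
    by_cases h5 : len (y * g) < len (sAff i.succ * (y * g))
    · have e := T_sAff_mul_of_lt q hr h5
      rw [sAff_succ] at e
      rw [e, ← mul_assoc] at h4
      exact ⟨a, h4⟩
    · have e := T_sAff_mul_of_not_lt q hr h5
      rw [sAff_succ] at e
      rw [e, ← mul_assoc] at h4
      -- When `s_i` shortens `y g`, the leading term gains a factor `q`, and the term with factor `q
      -- - 1` joins the lower ones.
      refine ⟨a + 1, ?_⟩
      have h6 := S.add_mem h4 (S.smul_mem (q ^ a * (q - 1)) m)
      convert h6 using 1
      rw [pow_succ]
      module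

end Coefficients

/-! ### Homomorphisms between the right ideals and the values of the products -/

section Hom

variable {k : Type*} [Field k] {q : k} {r : ℕ}

theorem mem_ideal_iff {K : Finset (Fin r)} {x : Hecke q r} :
    x ∈ ideal q K ↔ ∃ a, x = v q K * a := by
  rw [ideal, Submodule.mem_span_singleton]
  constructor
  · rintro ⟨a, rfl⟩; exact ⟨a.unop, rfl⟩
  · rintro ⟨a, rfl⟩; exact ⟨MulOpposite.op a, rfl⟩

theorem hom_apply {J K : Finset (Fin r)} (f : HomH q J K) {y : ideal q J} {a : Hecke q r}
    (hy : (y : Hecke q r) = v q J * a) : (f y : Hecke q r) = f (gen q J) * a := by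
  have : y = MulOpposite.op a • gen q J := Subtype.ext hy
  rw [this, map_smul]
  rfl

theorem leftConst_of_mem_ideal (hr : 1 ≤ r) (hq : q ≠ 0) {K : Finset (Fin r)} {x : Hecke q r}
    (hx : x ∈ ideal q K) : LeftConst K x := by
  obtain ⟨a, rfl⟩ := mem_ideal_iff.1 hx
  exact (leftConst_v hr hq subset_rfl).mul a

theorem mem_ideal_of_leftConst (hr : 1 ≤ r) (hq : q ≠ 0) {K : Finset (Fin r)} {x : Hecke q r}
    (hx : LeftConst K x) : x ∈ ideal q K :=
  mem_ideal_iff.2 ⟨_, hx.eq_mul hr hq⟩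

theorem leftConst_hom (hr : 1 ≤ r) (hq : q ≠ 0) {J K : Finset (Fin r)} (f : HomH q J K) :
    LeftConst K (f (gen q J) : Hecke q r) :=
  leftConst_of_mem_ideal hr hq (f (gen q J)).2

/-- The element `v_J T_s = q v_J` is written in two ways as a multiple of the generator, and `f`
respects both. -/
theorem rightConst_hom (hr : 1 ≤ r) (hq : q ≠ 0) {J K : Finset (Fin r)} (f : HomH q J K) :
    RightConst J (f (gen q J) : Hecke q r) := by
  intro i hi
  have e : v q J * T q (s i) = v q J * algebraMap k _ q := by
    rw [rightConst_v hr hq subset_rfl i hi, Algebra.algebraMap_eq_smul_one, mul_smul_comm, mul_one]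
  have h1 := hom_apply f (y := ⟨_, mem_ideal_iff.2 ⟨T q (s i), rfl⟩⟩) rfl
  have h2 := hom_apply f (y := ⟨_, mem_ideal_iff.2 ⟨T q (s i), rfl⟩⟩) e
  rw [← h1, h2, Algebra.algebraMap_eq_smul_one, mul_smul_comm, mul_one]

/-- Every element which is constant on double cosets is the value at `v_J` of a homomorphism. -/
theorem exists_hom (hr : 1 ≤ r) (hq : q ≠ 0) {J K : Finset (Fin r)} {h : Hecke q r}
    (h1 : LeftConst K h) (h2 : RightConst J h) : ∃ f : HomH q J K, (f (gen q J) : Hecke q r) = h := by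
  -- Since `h = c v_J`, left multiplication by `c` is right `H`-linear and sends `v_J` to `h`.
  set c := rightPart hr J h
  have hc : h = c * v q J := h2.eq_mul hr hq
  let F : Hecke q r →ₗ[(Hecke q r)ᵐᵒᵖ] Hecke q r :=
    { toFun := fun x => c * x
      map_add' := fun x y => mul_add c x y
      map_smul' := fun a x => (mul_assoc c x a.unop).symm }
  have hF : ∀ x : ideal q J, F x ∈ ideal q K := by
    rintro ⟨x, hx⟩
    obtain ⟨a, rfl⟩ := mem_ideal_iff.1 hx
    change c * (v q J * a) ∈ ideal q K
    rw [← mul_assoc, ← hc]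
    exact mem_ideal_of_leftConst hr hq (h1.mul a)
  exact ⟨(F ∘ₗ (ideal q J).subtype).codRestrict _ hF, hc.symm⟩

theorem b_gen (hr : 1 ≤ r) (hq : q ≠ 0) (K J : Finset (Fin r)) (d : W r) :
    (b q K J d (gen q J) : Hecke q r) = dsum q K J d := by
  have h := exists_hom hr hq (leftConst_dsum hr hq K J d) (rightConst_dsum hr hq K J d)
  rw [b, dif_pos h]
  exact h.choose_spec

/-- Evaluation of a homomorphism at `v_J`. -/
noncomputable def evalGen (q : k) {r : ℕ} (J K : Finset (Fin r)) : HomH q J K →ₗ[k] Hecke q r where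
  toFun f := f (gen q J)
  map_add' _ _ := rfl
  map_smul' _ _ := rfl

theorem evalGen_injective (J K : Finset (Fin r)) : Function.Injective (evalGen q J K) :=
  fun _ _ h => hom_ext q (Subtype.ext h)

theorem dsum_one_of_subset_right (hr : 1 ≤ r) {J K : Finset (Fin r)} (h : J ⊆ K) :
    dsum q J K 1 = v q K := by
  classical
  refine ext_coef hr fun z => ?_
  rw [coef_dsum, coef_v]
  refine if_congr ⟨?_, fun hz => ⟨1, one_mem _, z, hz, by simp⟩⟩ rfl rfl
  rintro ⟨x, hx, y, hy, rfl⟩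
  rw [mul_one]
  exact mul_mem (parabolic_mono h hx) hy

theorem dsum_one_of_subset_left (hr : 1 ≤ r) {J K : Finset (Fin r)} (h : J ⊆ K) :
    dsum q K J 1 = v q K := by
  classical
  refine ext_coef hr fun z => ?_
  rw [coef_dsum, coef_v]
  refine if_congr ⟨?_, fun hz => ⟨z, hz, 1, one_mem _, by simp⟩⟩ rfl rfl
  rintro ⟨x, hx, y, hy, rfl⟩
  rw [mul_one]
  exact mul_mem hx (parabolic_mono h hy)

/-- Compare the images in the symmetric group, where monomials become trivial. -/
theorem eq_of_mono_mul (p : Fin (r + 1) → ℤ) {J K : Finset (Fin r)} {x y : W r}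
    (hx : x ∈ parabolic J) (hy : y ∈ parabolic K) (h : mono p * y = x * mono p) : x = y := by
  obtain ⟨σ, rfl⟩ := exists_perm_of_mem hx
  obtain ⟨ρ, rfl⟩ := exists_perm_of_mem hy
  rw [eq_of_mono_mul_perm h]

/-- The composite of `b^p_{J,J}` and the inclusion `b^1_{J,K}` is a multiple of `b^p_{J,K}` by a
power of `q`. -/
theorem exists_dsum_mul_eq (hr : 1 ≤ r) (hq : q ≠ 0) {J K : Finset (Fin r)} (h : J ⊆ K)
    (p : Fin (r + 1) → ℤ) {m : Hecke q r} (hm : v q K = v q J * m) :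
    ∃ c : k, c ≠ 0 ∧ dsum q J J (mono p) * m = c • dsum q J K (mono p) := by
  classical
  set S := dsum q J J (mono p) * m with hS
  have h1 : LeftConst J S := (leftConst_dsum hr hq J J (mono p)).mul m
  -- The double coset sum has the form `c v_J`, and `v_J m = v_K`. So `S` is a sum of terms `T_g
  -- v_K` over right minimal `g` in `W_J p W_J`.
  have h2 : S = rightPart hr J (dsum q J J (mono p)) * v q K := by
    rw [hS, (rightConst_dsum hr hq J J (mono p)).eq_mul hr hq, mul_assoc, ← hm]
    rw [← (rightConst_dsum hr hq J J (mono p)).eq_mul hr hq]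
  have h3 : RightConst K S := by
    rw [h2]; exact (rightConst_v hr hq subset_rfl).mul _
  choose a ha using fun g => T_mul_v (q := q) hr hq K g
  have h4 : ∀ z, coef hr z S = ∑ g ∈ ((basisT q hr).repr (dsum q J J (mono p))).support.filter
      (RightMin J), coef hr g (dsum q J J (mono p)) * (q ^ a g *
        if z ∈ dcoset ∅ K g then 1 else 0) := by
    intro z
    rw [h2, rightPart, Finset.sum_mul, map_sum]
    refine Finset.sum_congr rfl fun g _ => ?_
    rw [smul_mul_assoc, ha, map_smul, map_smul, coef_dsum hr ∅ K g z, smul_eq_mul, smul_eq_mul]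
  have hmem : ∀ g ∈ ((basisT q hr).repr (dsum q J J (mono p))).support.filter (RightMin J),
      g ∈ dcoset J J (mono p) ∧ RightMin J g := by
    intro g hg
    obtain ⟨hg1, hg2⟩ := Finset.mem_filter.1 hg
    refine ⟨?_, hg2⟩
    by_contra hn
    have hg3 : coef hr g (dsum q J J (mono p)) ≠ 0 := Finsupp.mem_support_iff.1 hg1
    rw [coef_dsum, if_neg hn] at hg3
    exact hg3 rfl
  obtain ⟨y, hy, hmin⟩ := exists_rightMin J (mono p)
  have hc : coef hr (mono p) S = q ^ a (mono p * y) := by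
    have hyd : mono p * y ∈ dcoset J J (mono p) := ⟨1, one_mem _, y, hy, by simp⟩
    -- Only one `g` contributes at `p`, so the coefficient is a single power of `q`: if `p` lies in
    -- `g W_K`, comparison of finite parts puts `g` in `p W_J`, whose minimal element is unique.
    rw [h4, Finset.sum_eq_single (mono p * y)]
    · rw [coef_dsum, if_pos hyd, if_pos, one_mul, mul_one]
      exact mem_dcoset_empty_left.2 ⟨y⁻¹, parabolic_mono h (inv_mem hy), by group⟩
    · intro g hg hne
      rw [if_neg, mul_zero, mul_zero]
      intro hpg
      obtain ⟨z, hz, e⟩ := mem_dcoset_empty_left.1 hpg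
      obtain ⟨⟨x1, hx1, y1, hy1, e1⟩, hgmin⟩ := hmem g hg
      have e2 : x1⁻¹ = y1 * z := by
        apply eq_of_mono_mul p (inv_mem hx1) (mul_mem (parabolic_mono h hy1) hz)
        nth_rw 2 [e]
        rw [e1]; group
      have hzJ : z ∈ parabolic J := by
        have : z = y1⁻¹ * x1⁻¹ := by rw [e2]; group
        rw [this]
        exact mul_mem (inv_mem hy1) (inv_mem hx1)
      exact hne (hmin.eq_of_mem hr hgmin (mul_mem (inv_mem hy) (inv_mem hzJ)) (by
        have : g = mono p * z⁻¹ := by rw [e]; group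
        rw [this]; group))
    · intro hn
      exfalso
      apply hn
      refine Finset.mem_filter.2 ⟨Finsupp.mem_support_iff.2 ?_, hmin⟩
      change coef hr _ _ ≠ 0
      rw [coef_dsum, if_pos hyd]
      exact one_ne_zero
  refine ⟨coef hr (mono p) S, by rw [hc]; exact pow_ne_zero _ hq, ext_coef hr fun z => ?_⟩
  rw [map_smul, coef_dsum, smul_eq_mul]
  split_ifs with hz
  · rw [mul_one, coef_eq_of_mem_dcoset hr hq h1 h3 hz]
  · rw [mul_zero, h4]
    refine Finset.sum_eq_zero fun g hg => ?_
    rw [if_neg, mul_zero, mul_zero]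
    intro hzg
    obtain ⟨y', hy', rfl⟩ := mem_dcoset_empty_left.1 hzg
    obtain ⟨⟨x1, hx1, y1, hy1, rfl⟩, -⟩ := hmem g hg
    exact hz ⟨x1, hx1, y1 * y', mul_mem (parabolic_mono h hy1) hy', by group⟩

/-- The four factors are applied in turn to `v_{K₁}`. The first is the inclusion of `v_{K₁}H` in
`v_J H`, the second contributes the scalar of `exists_dsum_mul_eq`. In the third, `w W_J w⁻¹ =
W_{wJ}` reduces the double coset sum to `v_{wJ} T_w`, and the last replaces `v_{wJ}` by `v_{K₂}`. -/
theorem basisElt_gen (hr : 1 ≤ r) (hq : q ≠ 0) {K₁ K₂ : Finset (Fin r)} (x : Label K₂ K₁) :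
    ∃ c : k, c ≠ 0 ∧ evalGen q K₁ K₂ (basisElt q K₂ K₁ x) =
      c • (v q K₂ * (T q (perm x.1.1) *
        leftPart hr (meet K₁ K₂ x.1.1) (dsum q (meet K₁ K₂ x.1.1) K₁ (mono x.1.2)))) := by
  classical
  obtain ⟨⟨w, p⟩, hw, hp⟩ := x
  simp only
  set J := meet K₁ K₂ w with hJ
  have hJ1 : J ⊆ K₁ := meet_subset K₁ K₂ w
  have hJ2 : conj w J ⊆ K₂ := conj_meet_subset K₁ K₂ w
  have hm : v q K₁ = v q J * leftPart hr J (v q K₁) := (leftConst_v hr hq hJ1).eq_mul hr hq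
  obtain ⟨c, hc, e⟩ := exists_dsum_mul_eq hr hq hJ1 p hm
  refine ⟨c, hc, ?_⟩
  set h5 := leftPart hr J (dsum q J K₁ (mono p))
  have h5e : dsum q J K₁ (mono p) = v q J * h5 := (leftConst_dsum hr hq J K₁ (mono p)).eq_mul hr hq
  have e1 : (b q J K₁ 1 (gen q K₁) : Hecke q r) = v q J * leftPart hr J (v q K₁) := by
    rw [b_gen hr hq, dsum_one_of_subset_right hr hJ1, ← hm]
  have e2 := hom_apply (b q J J (mono p)) e1
  rw [b_gen hr hq, e, h5e, ← mul_smul_comm] at e2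
  have e3 := hom_apply (b q (conj w J) J (perm w)) e2
  have e4 : dsum q (conj w J) J (perm w) = v q (conj w J) * T q (perm w) := by
    rw [v_mul_T_of_leftMin hr fun x hx => leftMin_of_shortest hw x (parabolic_mono hJ2 hx)]
    refine ext_coef hr fun z => ?_
    rw [coef_dsum, coef_dsum]
    refine if_congr ⟨?_, ?_⟩ rfl rfl
    · rintro ⟨x, hx, y, hy, rfl⟩
      exact mem_dcoset_empty_right.2 ⟨x * (perm w * y * (perm w)⁻¹),
        mul_mem hx (conj_mem_parabolic hy), by group⟩
    · intro hz
      obtain ⟨x, hx, rfl⟩ := mem_dcoset_empty_right.1 hz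
      exact ⟨x, hx, 1, one_mem _, by simp⟩
  rw [b_gen hr hq, e4, mul_assoc] at e3
  have e5 := hom_apply (b q K₂ (conj w J) 1) e3
  rw [b_gen hr hq, dsum_one_of_subset_left hr hJ2, mul_smul_comm, mul_smul_comm] at e5
  exact e5

end Hom

/-! ### Triangularity with respect to the length of `w` -/

section Triangular

variable {k : Type*} [Field k] {q : k} {r : ℕ}

theorem perm_mem_parabolic_univ (σ : Equiv.Perm (Fin (r + 1))) :
    perm σ ∈ parabolic (Finset.univ : Finset (Fin r)) := by
  have h : σ ∈ Submonoid.closure (Set.range fun i : Fin r => Equiv.swap i.castSucc i.succ) := by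
    rw [Equiv.Perm.mclosure_swap_castSucc_succ]; trivial
  induction h using Submonoid.closure_induction with
  | mem x hx => obtain ⟨i, rfl⟩ := hx; exact s_mem_parabolic (Finset.mem_univ i)
  | one => exact one_mem _
  | mul x y _ _ hx hy => rw [perm_mul]; exact mul_mem hx hy

/-- Elements supported on double cosets lying over double cosets in the symmetric group that
contain an element of length less than `n`. -/
noncomputable def lowerTerms (q : k) (hr : 1 ≤ r) (K₂ K₁ : Finset (Fin r)) (n : ℕ) :
    Submodule k (Hecke q r) where
  carrier := {h | ∀ z, coef hr z h ≠ 0 →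
    ∃ σ, len (perm σ) < n ∧ perm z.right ∈ dcoset K₂ K₁ (perm σ)}
  zero_mem' := fun z hz => absurd (map_zero _) hz
  add_mem' := by
    intro a b ha hb z hz
    by_cases h : coef hr z a = 0
    · exact hb z fun h' => hz (by rw [map_add, h, h', add_zero])
    · exact ha z h
  smul_mem' := by
    intro c a ha z hz
    exact ha z fun h' => hz (by rw [map_smul, h', smul_zero])

/-- By `T_mul_T` for the full symmetric group, the corrections to `T_w T_g` are combinations of
`T_{ug}` with `u` a permutation shorter than `w`. The finite part of `g` lies in `W_{K₁}`, so these
terms lie over the finite double coset of `u`. -/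
theorem exists_leading_terms (hr : 1 ≤ r) (hq : q ≠ 0) {K₁ K₂ J : Finset (Fin r)} (hJ : J ⊆ K₁)
    (w : Equiv.Perm (Fin (r + 1))) {g : W r} {p : Fin (r + 1) → ℤ}
    (hg : g ∈ dcoset J K₁ (mono p)) :
    ∃ a : ℕ, v q K₂ * (T q (perm w) * T q g) - q ^ a • dsum q K₂ ∅ (perm w * g) ∈
      lowerTerms q hr K₂ K₁ (len (perm w)) := by
  classical
  obtain ⟨a, ha⟩ := T_mul_T (q := q) hr _ (perm_mem_parabolic_univ w) g
  obtain ⟨b, hb⟩ := v_mul_T (q := q) hr hq K₂ (perm w * g)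
  refine ⟨a + b, ?_⟩
  have h1 : ∀ z ∈ Submodule.span k {z | ∃ u ∈ parabolic (Finset.univ : Finset (Fin r)),
      len u < len (perm w) ∧ T q (u * g) = z},
      v q K₂ * z ∈ lowerTerms q hr K₂ K₁ (len (perm w)) := by
    intro z hz
    induction hz using Submodule.span_induction with
    | mem z hz =>
      obtain ⟨u, hu, hlt, rfl⟩ := hz
      obtain ⟨σ, rfl⟩ := exists_perm_of_mem hu
      obtain ⟨c, hc⟩ := v_mul_T (q := q) hr hq K₂ (perm σ * g)
      rw [hc]
      refine Submodule.smul_mem _ _ fun z hz => ⟨σ, hlt, ?_⟩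
      have hz' : z ∈ dcoset K₂ ∅ (perm σ * g) := by
        by_contra hn
        rw [coef_dsum, if_neg hn] at hz
        exact hz rfl
      obtain ⟨x, hx, rfl⟩ := mem_dcoset_empty_right.1 hz'
      obtain ⟨y, hy, t, ht, rfl⟩ := hg
      have ht' := mul_mem (parabolic_mono hJ hy) ht
      refine ⟨x, hx, y * t, ht', ?_⟩
      obtain ⟨_, rfl⟩ := exists_perm_of_mem hx
      obtain ⟨_, rfl⟩ := exists_perm_of_mem hy
      obtain ⟨_, rfl⟩ := exists_perm_of_mem ht
      simp only [← perm_mul]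
      congr 1
    | zero => rw [mul_zero]; exact Submodule.zero_mem _
    | add x y _ _ hx hy => rw [mul_add]; exact Submodule.add_mem _ hx hy
    | smul c x _ hx => rw [mul_smul_comm]; exact Submodule.smul_mem _ _ hx
  have h2 := h1 _ ha
  rw [mul_sub, mul_smul_comm, hb, smul_smul, ← pow_add] at h2
  exact h2

/-- The leading double coset of a product of the proposed basis. -/
theorem basisElt_triangular (hr : 1 ≤ r) (hq : q ≠ 0) {K₁ K₂ : Finset (Fin r)} (x : Label K₂ K₁) :
    coef hr x.elt (evalGen q K₁ K₂ (basisElt q K₂ K₁ x)) ≠ 0 ∧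
    ∀ z, coef hr z (evalGen q K₁ K₂ (basisElt q K₂ K₁ x)) ≠ 0 → z ∈ dcoset K₂ K₁ x.elt ∨
      ∃ σ, len (perm σ) < len (perm x.1.1) ∧ perm z.right ∈ dcoset K₂ K₁ (perm σ) := by
  classical
  obtain ⟨c, hc, e⟩ := basisElt_gen hr hq x
  obtain ⟨⟨w, p⟩, hw, hp⟩ := x
  simp only at e ⊢
  change coef hr (perm w * mono p) _ ≠ 0 ∧ ∀ z, _ → z ∈ dcoset K₂ K₁ (perm w * mono p) ∨ _
  rw [e]
  set J := meet K₁ K₂ w with hJ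
  have hJ1 : J ⊆ K₁ := meet_subset K₁ K₂ w
  have hJ2 : conj w J ⊆ K₂ := conj_meet_subset K₁ K₂ w
  set F := ((basisT q hr).repr (dsum q J K₁ (mono p))).support.filter (LeftMin J) with hF
  have hmem : ∀ g, g ∈ F ↔ g ∈ dcoset J K₁ (mono p) ∧ LeftMin J g := by
    intro g
    rw [hF, Finset.mem_filter, Finsupp.mem_support_iff]
    change coef hr g _ ≠ 0 ∧ _ ↔ _
    rw [coef_dsum]
    simp
  choose! a ha using fun g (hg : g ∈ F) =>
    exists_leading_terms (K₂ := K₂) hr hq hJ1 w ((hmem g).1 hg).1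
  set E := v q K₂ * (T q (perm w) * leftPart hr J (dsum q J K₁ (mono p))) with hE
  have hE2 : E - ∑ g ∈ F, q ^ a g • dsum q K₂ ∅ (perm w * g) ∈
      lowerTerms q hr K₂ K₁ (len (perm w)) := by
    rw [hE, leftPart, Finset.mul_sum, Finset.mul_sum, ← Finset.sum_sub_distrib]
    refine Submodule.sum_mem _ fun g hg => ?_
    rw [coef_dsum, if_pos ((hmem g).1 hg).1, one_smul]
    exact ha g hg
  have hcoef : ∀ z, coef hr z (E - ∑ g ∈ F, q ^ a g • dsum q K₂ ∅ (perm w * g)) =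
      coef hr z E - ∑ g ∈ F, q ^ a g * if z ∈ dcoset K₂ ∅ (perm w * g) then 1 else 0 := by
    intro z
    rw [map_sub, map_sum]
    congr 1
    refine Finset.sum_congr rfl fun g _ => ?_
    rw [map_smul, coef_dsum, smul_eq_mul]
  have hconj : ∀ y ∈ parabolic J, perm w * y * (perm w)⁻¹ ∈ parabolic K₂ := fun y hy =>
    parabolic_mono hJ2 (conj_mem_parabolic hy)
  constructor
  -- Lower terms cannot reach `w p`: its finite part `w` is shortest in its double coset, which
  -- therefore contains no shorter permutation.
  · have h0 : coef hr (perm w * mono p)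
        (E - ∑ g ∈ F, q ^ a g • dsum q K₂ ∅ (perm w * g)) = 0 := by
      by_contra hne
      obtain ⟨σ, h1, h2⟩ := hE2 _ hne
      rw [right_perm_mul_mono] at h2
      exact absurd (hw _ (mem_dcoset_symm h2)) (not_le.2 h1)
    obtain ⟨y, hy, hmin⟩ := exists_leftMin J (mono p)
    have hyF : y * mono p ∈ F := (hmem _).2 ⟨⟨y, hy, 1, one_mem _, by simp⟩, hmin⟩
    -- Let `g = x₁ p y₁` contribute at `w p`. The finite parts give `w = u w x₁ y₁`, so `x₁ y₁` lies
    -- in `W_{K₁} ∩ w⁻¹ W_{K₂} w = W_J`, and `g` is the unique minimal element of `W_J p`.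
    rw [hcoef, sub_eq_zero, Finset.sum_eq_single (y * mono p)] at h0
    · rw [if_pos, mul_one] at h0
      · rw [map_smul, smul_eq_mul, h0]
        exact mul_ne_zero hc (pow_ne_zero _ hq)
      · exact mem_dcoset_empty_right.2 ⟨perm w * y⁻¹ * (perm w)⁻¹, hconj _ (inv_mem hy), by group⟩
    · intro g hg hne
      rw [if_neg, mul_zero]
      intro hz
      obtain ⟨u, hu, e1⟩ := mem_dcoset_empty_right.1 hz
      obtain ⟨⟨x1, hx1, y1, hy1, rfl⟩, hgmin⟩ := (hmem g).1 hg
      have hx1' := parabolic_mono hJ1 hx1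
      have e3 : mono p * y1 = (u * perm w * x1)⁻¹ * perm w * mono p := by
        rw [mul_assoc _ (perm w), e1]; group
      have e2 : (u * perm w * x1)⁻¹ * perm w = y1 :=
        eq_of_mono_mul p (mul_mem (inv_mem (mul_mem (mul_mem
          (parabolic_mono (Finset.subset_univ _) hu) (perm_mem_parabolic_univ w))
          (parabolic_mono (Finset.subset_univ _) hx1))) (perm_mem_parabolic_univ w)) hy1 e3
      rw [e2] at e3
      have h3 : x1 * y1 ∈ parabolic J := by
        refine mem_parabolic_meet hr hw (mul_mem hx1' hy1) ?_
        have : perm w * (x1 * y1) * (perm w)⁻¹ = u⁻¹ := by rw [← e2]; group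
        rw [this]
        exact inv_mem hu
      exact hne (hmin.eq_of_mem hr hgmin (mul_mem h3 (inv_mem hy)) (by
        rw [mul_assoc x1 (mono p), e3]; group))
    · intro hn; exact absurd hyF hn
  · intro z hz
    by_cases h0 : coef hr z (E - ∑ g ∈ F, q ^ a g • dsum q K₂ ∅ (perm w * g)) = 0
    · left
      rw [hcoef, sub_eq_zero] at h0
      rw [map_smul, h0, smul_eq_mul] at hz
      obtain ⟨g, hg, hne⟩ := Finset.exists_ne_zero_of_sum_ne_zero (right_ne_zero_of_mul hz)
      have hzg : z ∈ dcoset K₂ ∅ (perm w * g) := by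
        by_contra hn
        rw [if_neg hn, mul_zero] at hne
        exact hne rfl
      obtain ⟨u, hu, rfl⟩ := mem_dcoset_empty_right.1 hzg
      obtain ⟨⟨x1, hx1, y1, hy1, rfl⟩, -⟩ := (hmem g).1 hg
      exact ⟨u * (perm w * x1 * (perm w)⁻¹), mul_mem hu (hconj _ hx1), y1, hy1, by group⟩
    · right
      exact hE2 z h0

end Triangular

/-! ### Bases of the Hom spaces and of the affine Schur algebra -/

section Basis

variable {k : Type*} [Field k] {q : k} {r : ℕ}

/-- In a linear relation choose a label `x = (w, p)` with nonzero coefficient and `w` of maximal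
length. By triangularity no other product in the relation has a nonzero coefficient at `w p`. -/
theorem linearIndependent_basisElt (hr : 1 ≤ r) (hq : q ≠ 0) (K₁ K₂ : Finset (Fin r)) :
    LinearIndependent k (basisElt q K₂ K₁) := by
  classical
  apply LinearIndependent.of_comp (evalGen q K₁ K₂)
  rw [linearIndependent_iff']
  intro t g hsum i hi
  by_contra hgi
  obtain ⟨x, hx, hmax⟩ := Finset.exists_max_image (t.filter fun y => g y ≠ 0)
    (fun y => len (perm y.1.1)) ⟨i, Finset.mem_filter.2 ⟨hi, hgi⟩⟩
  rw [Finset.mem_filter] at hx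
  have h := congrArg (coef hr x.elt) hsum
  rw [map_sum, map_zero, Finset.sum_eq_single x] at h
  · rw [map_smul, smul_eq_mul] at h
    exact mul_ne_zero hx.2 (basisElt_triangular hr hq x).1 h
  · intro y hy hne
    by_contra hyx
    rw [map_smul, smul_eq_mul] at hyx
    have hgy := left_ne_zero_of_mul hyx
    rcases (basisElt_triangular hr hq y).2 _ (right_ne_zero_of_mul hyx) with h1 | ⟨σ, h1, h2⟩
    · exact hne (Label.eq_of_mem hr h1).symm
    · rw [Label.elt_right] at h2
      have h3 := x.2.1 _ (mem_dcoset_symm h2)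
      have h4 := hmax y (Finset.mem_filter.2 ⟨hy, hgy⟩)
      omega
  · intro hn; exact absurd hx.1 hn

theorem dsum_eq_of_mem {K J : Finset (Fin r)} {d u : W r} (h : u ∈ dcoset K J d) :
    dsum q K J u = dsum q K J d := by
  have := dcoset_eq h
  rw [dsum, dsum]
  congr 1
  ext; simp [this]

/-- Inversion of the triangular system by induction on the length of `w`. There are infinitely many
labels for a given `w`, but the remainder involves only labels with a strictly shorter permutation.
-/
theorem dsum_label_mem (hr : 1 ≤ r) (hq : q ≠ 0) {K₁ K₂ : Finset (Fin r)} (x : Label K₂ K₁) :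
    dsum q K₂ K₁ x.elt ∈
      (Submodule.span k (Set.range (basisElt q K₂ K₁))).map (evalGen q K₁ K₂) := by
  classical
  set M := (Submodule.span k (Set.range (basisElt q K₂ K₁))).map (evalGen q K₁ K₂)
  induction hn : len (perm x.1.1) using Nat.strong_induction_on generalizing x with
  | _ n ih =>
  set E : Hecke q r := evalGen q K₁ K₂ (basisElt q K₂ K₁ x) with hE
  have hEM : E ∈ M := Submodule.mem_map_of_mem (Submodule.subset_span ⟨x, rfl⟩)
  have hc : coef hr x.elt E ≠ 0 := (basisElt_triangular hr hq x).1
  have hE1 : LeftConst K₂ E := leftConst_hom hr hq _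
  have hE2 : RightConst K₁ E := rightConst_hom hr hq _
  set E' := E - coef hr x.elt E • dsum q K₂ K₁ x.elt with hE'
  have h1 := mem_span_dsum hr hq (hE1.sub_smul (leftConst_dsum hr hq K₂ K₁ x.elt) _)
    (hE2.sub_smul (rightConst_dsum hr hq K₂ K₁ x.elt) (coef hr x.elt E))
  rw [← hE'] at h1
  have h2 : E' ∈ M := by
    refine (Submodule.span_le.2 ?_ : _ ≤ M) h1
    rintro _ ⟨d, hd, rfl⟩
    have hd' : coef hr d E' ≠ 0 := hd
    rw [hE', map_sub, map_smul, coef_dsum, smul_eq_mul] at hd'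
    have hdx : d ∉ dcoset K₂ K₁ x.elt := by
      intro hdx
      rw [if_pos hdx, mul_one, coef_eq_of_mem_dcoset hr hq hE1 hE2 hdx, sub_self] at hd'
      exact hd' rfl
    rw [if_neg hdx, mul_zero, sub_zero] at hd'
    obtain ⟨σ, h3, h4⟩ := ((basisElt_triangular hr hq x).2 d hd').resolve_left hdx
    obtain ⟨y, hy⟩ := exists_label (K₂ := K₂) (K₁ := K₁) d
    have h5 := perm_right_mem_dcoset hy
    rw [Label.elt_right] at h5
    have h6 : perm σ ∈ dcoset K₂ K₁ (perm y.1.1) := by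
      rw [← dcoset_eq h5]; exact mem_dcoset_symm h4
    have h7 := y.2.1 _ h6
    change dsum q K₂ K₁ d ∈ M
    rw [dsum_eq_of_mem hy]
    exact ih _ (by omega) y rfl
  have h3 : coef hr x.elt E • dsum q K₂ K₁ x.elt ∈ M := by
    have := M.sub_mem hEM h2
    rwa [hE', sub_sub_cancel] at this
  exact (M.smul_mem_iff hc).1 h3

theorem span_basisElt (hr : 1 ≤ r) (hq : q ≠ 0) (K₁ K₂ : Finset (Fin r)) :
    Submodule.span k (Set.range (basisElt q K₂ K₁)) = ⊤ := by
  rw [eq_top_iff]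
  intro f _
  have h1 : evalGen q K₁ K₂ f ∈
      (Submodule.span k (Set.range (basisElt q K₂ K₁))).map (evalGen q K₁ K₂) := by
    refine (Submodule.span_le.2 ?_) (mem_span_dsum hr hq (leftConst_hom hr hq f)
      (rightConst_hom hr hq f))
    rintro _ ⟨d, -, rfl⟩
    obtain ⟨y, hy⟩ := exists_label (K₂ := K₂) (K₁ := K₁) d
    rw [dsum_eq_of_mem hy]
    exact dsum_label_mem hr hq y
  obtain ⟨g, hg, e⟩ := h1
  rwa [← evalGen_injective K₁ K₂ e]

/-- The matrix entries of an element of the affine Schur algebra. -/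
noncomputable def entries (q : k) (r : ℕ) :
    Schur q r →ₗ[k] (∀ P : Finset (Fin r) × Finset (Fin r), HomH q P.1 P.2) where
  toFun φ P := DirectSum.component (Hecke q r)ᵐᵒᵖ (Finset (Fin r)) (fun L => ideal q L) P.2 ∘ₗ φ ∘ₗ
    DirectSum.lof (Hecke q r)ᵐᵒᵖ (Finset (Fin r)) (fun L => ideal q L) P.1
  map_add' _ _ := rfl
  map_smul' _ _ := rfl

theorem entries_injective (q : k) (r : ℕ) : Function.Injective (entries q r) := by
  intro φ ψ h
  refine DirectSum.linearMap_ext _ fun J => LinearMap.ext fun x => ?_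
  refine DFinsupp.ext fun K => ?_
  exact LinearMap.congr_fun (congrFun h (J, K)) x

theorem entries_toSchur_apply {J K J' K' : Finset (Fin r)} (f : HomH q J K) (x : ideal q J') :
    entries q r (toSchur q f) (J', K') x =
      DirectSum.component (Hecke q r)ᵐᵒᵖ (Finset (Fin r)) (fun L => ideal q L) K'
        (DirectSum.lof (Hecke q r)ᵐᵒᵖ (Finset (Fin r)) (fun L => ideal q L) K
          (f (DirectSum.component (Hecke q r)ᵐᵒᵖ (Finset (Fin r)) (fun L => ideal q L) J
            (DirectSum.lof (Hecke q r)ᵐᵒᵖ (Finset (Fin r)) (fun L => ideal q L) J' x)))) := rfl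

/-- Extension by zero is the matrix with a single entry, so the proposed family corresponds to the
product basis of the matrix space. -/
theorem entries_toSchur (P : Finset (Fin r) × Finset (Fin r)) (f : HomH q P.1 P.2) :
    entries q r (toSchur q f) = Pi.single P f := by
  obtain ⟨J, K⟩ := P
  funext P
  obtain ⟨J', K'⟩ := P
  refine LinearMap.ext fun x => (entries_toSchur_apply f x).trans ?_
  by_cases hP : (J', K') = (J, K)
  · obtain ⟨rfl, rfl⟩ := Prod.mk.inj hP
    rw [Pi.single_eq_same, DirectSum.component.lof_self, DirectSum.component.lof_self]
  · rw [Pi.single_eq_of_ne hP, LinearMap.zero_apply, DirectSum.component.of]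
    split_ifs with hK
    · have hJ : J' ≠ J := by rintro rfl; exact hP (Prod.ext rfl hK.symm)
      subst hK
      rw [DirectSum.component.of, dif_neg hJ, map_zero]
    · rfl

/-- The basis of the affine Schur algebra, as matrix entries. -/
noncomputable def entriesBasis (hr : 1 ≤ r) (hq : q ≠ 0) :
    Module.Basis (Σ P : Finset (Fin r) × Finset (Fin r), Label P.2 P.1) k
      (∀ P : Finset (Fin r) × Finset (Fin r), HomH q P.1 P.2) :=
  Pi.basis fun P => Module.Basis.mk (linearIndependent_basisElt hr hq P.1 P.2)
    (span_basisElt hr hq P.1 P.2).ge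

theorem entriesBasis_apply (hr : 1 ≤ r) (hq : q ≠ 0)
    (x : Σ P : Finset (Fin r) × Finset (Fin r), Label P.2 P.1) :
    entriesBasis hr hq x = entries q r (toSchur q (basisElt q x.1.2 x.1.1 x.2)) := by
  rw [entries_toSchur, entriesBasis, Pi.basis_apply, Module.Basis.mk_apply]

end Basis

end AffSchur

theorem mainTheorem7 {k : Type*} [Field k] (q : k) (hq : q ≠ 0) (r : ℕ) (hr : 1 ≤ r) :
    (∀ (K J : Finset (Fin r)) (d : AffSchur.W r),
      (AffSchur.b q K J d (AffSchur.gen q J) : AffSchur.Hecke q r) = AffSchur.dsum q K J d) ∧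
    (∀ K₁ K₂ : Finset (Fin r),
      LinearIndependent k (AffSchur.basisElt q K₂ K₁) ∧
      Submodule.span k (Set.range (AffSchur.basisElt q K₂ K₁)) = ⊤) ∧
    (LinearIndependent k
      (fun x : (Σ K : Finset (Fin r) × Finset (Fin r), AffSchur.Label K.2 K.1) =>
        AffSchur.toSchur q (AffSchur.basisElt q x.1.2 x.1.1 x.2)) ∧
     Submodule.span k (Set.range
      (fun x : (Σ K : Finset (Fin r) × Finset (Fin r), AffSchur.Label K.2 K.1) =>
        AffSchur.toSchur q (AffSchur.basisElt q x.1.2 x.1.1 x.2))) = ⊤) := by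
  have e : ⇑(AffSchur.entriesBasis hr hq) = AffSchur.entries q r ∘
      fun x : (Σ K : Finset (Fin r) × Finset (Fin r), AffSchur.Label K.2 K.1) =>
        AffSchur.toSchur q (AffSchur.basisElt q x.1.2 x.1.1 x.2) :=
    funext fun x => AffSchur.entriesBasis_apply hr hq x
  refine ⟨AffSchur.b_gen hr hq, fun K₁ K₂ => ⟨AffSchur.linearIndependent_basisElt hr hq K₁ K₂,
    AffSchur.span_basisElt hr hq K₁ K₂⟩, ?_, ?_⟩
  · apply LinearIndependent.of_comp (AffSchur.entries q r)
    rw [← e]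
    exact (AffSchur.entriesBasis hr hq).linearIndependent
  -- The matrix entries determine an endomorphism, so images may be compared: the image of the span
  -- is already the whole matrix space.
  · apply Submodule.map_injective_of_injective (AffSchur.entries_injective q r)
    rw [Submodule.map_span, ← Set.range_comp, ← e, (AffSchur.entriesBasis hr hq).span_eq]
    refine le_antisymm ?_ le_top
    rw [← (AffSchur.entriesBasis hr hq).span_eq, Submodule.span_le]
    rintro _ ⟨x, rfl⟩
    rw [AffSchur.entriesBasis_apply]
    exact ⟨_, trivial, rfl⟩
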